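/- Let $G$ be a (Hausdorff) locally compact group which is separable (has a countable dense subset) and compactly generated, let $S\subset G$ be a compact symmetric generating set containing the identity, fix a left Haar measure $dg$ on $G$, and fix $M>1$. A representation $(\pi,E)$ of $G$ is a strongly continuous homomorphism $\pi$ from $G$ to the group of bounded invertible operators of a complex Banach space $E$; two representations are equivalent if a surjective linear isometry intertwines them. Put $E^\pi=\{x\in E:\pi(g)x=x\ \forall g\in G\}$ and, for $f\in C_c(G)$, $\pi(f)x=\int_G f(g)\pi(g)x\,dg$. $H^1(G,\pi)=Z^1(G,\pi)/B^1(G,\pi)$, where $Z^1(G,\pi)$ is the space of continuous maps $b:G\to E$ with $b(gh)=b(g)+\pi(g)b(h)$ and $B^1(G,\pi)$ is the space of the maps $g\mapsto x-\pi(g)x$, $x\in E$. Let $\mathcal R$ be the set of equivalence classes of representations $(\pi,E)$ of $G$ with $E$ separable and $\sup_{g\in S}\|\pi(g)\|\le M$. Equip $\mathcal R$ with the topology with basis the sets $W_{x_1,\dots,x_n,Q,\varepsilon}(\pi,E)$, for $(\pi,E)\in\mathcal R$, $x_1,\dots,x_n\in E$, $Q\subset G$ compact, $\varepsilon>0$,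 where $W_{x_1,\dots,x_n,Q,\varepsilon}(\pi,E)$ is the set of $(\pi',E')\in\mathcal R$ for which there are $x_1',\dots,x_n'\in E'$ with $$\sup_{f_1,\dots,f_n}\Big|\,\Big\|\sum_{k=1}^n\pi'(f_k)x_k'\Big\|-\Big\|\sum_{k=1}^n\pi(f_k)x_k\Big\|\,\Big|<\varepsilon,$$ the supremum being over all $f_1,\dots,f_n\in C_c(G)$ supported in $Q$ with $\|f_k\|_{L_1}\le1$. For subsets $A,B$ of a topological space $X$, $B$ is a strong neighbourhood of $A$ if $B$ belongs to every ultrafilter on $X$ all of whose accumulation points lie in $A$. For $\mathcal F\subset\mathcal R$, let $\mathcal C_{\mathcal F}(G)$ be the completion of $C_c(G)$ for the seminorm $\|f\|_{\mathcal F}=\sup_{(\pi,E)\in\mathcal F}\|\pi(f)\|$, a Banach algebra for convolution to which every $\pi$ in $\mathcal F$ extends. A Kazhdan projection in $\mathcal C_{\mathcal F}(G)$ is an idempotent $p$ in the closure of $\{f\in C_c(G):\int f=1\}$ such that $\pi(p)$ is a projection onto $E^\pi$ for every $(\pi,E)\in\mathcal F$. Theorem. Let $\mathcal F\subset\mathcal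 R$. Assume that $\mathcal C_{\mathcal F}(G)$ has a Kazhdan projection and that $H^1(G,\pi)=0$ for all $(\pi,E)\in\mathcal F$. Then there is a strong neighbourhood $\mathcal F'\subset\mathcal R$ of $\mathcal F$ such that $\mathcal C_{\mathcal F'}(G)$ has a Kazhdan projection and $H^1(G,\pi)=0$ for all $(\pi,E)\in\mathcal F'$. -/

import Mathlib

open MeasureTheory Topology UniformSpace
open scoped CompactlySupported Pointwise

universe u v

noncomputable section

/-- A strongly continuous representation of `G` on a complex Banach space. (A monoid homomorphism
from a group into the bounded operators takes its values in the invertible ones.) -/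
structure BanachRep (G : Type u) [Group G] [TopologicalSpace G] : Type (max u (v + 1)) where
  E : Type v
  [normedAddCommGroup : NormedAddCommGroup E]
  [normedSpace : NormedSpace ℂ E]
  [completeSpace : CompleteSpace E]
  π : G →* (E →L[ℂ] E)
  continuous_apply : ∀ x : E, Continuous fun g => π g x

attribute [instance] BanachRep.normedAddCommGroup BanachRep.normedSpace BanachRep.completeSpace

namespace BanachRep

section Basic

variable {G : Type u} [Group G] [TopologicalSpace G]

/-- Equivalence: a surjective linear isometry intertwines the two actions. -/
def Equivalent (ρ₁ ρ₂ : BanachRep.{u, v} G) : Prop :=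
  ∃ T : ρ₁.E ≃ₗᵢ[ℂ] ρ₂.E, ∀ g x, T (ρ₁.π g x) = ρ₂.π g (T x)

/-- The space `E^π` of invariant vectors. -/
def invariants (ρ : BanachRep.{u, v} G) : Submodule ℂ ρ.E where
  carrier := {x | ∀ g, ρ.π g x = x}
  add_mem' := by
    intro x y hx hy g
    rw [map_add, hx g, hy g]
  zero_mem' := fun g => map_zero _
  smul_mem' := by
    intro c x hx g
    rw [map_smul, hx g]

/-- `Z¹(G, π)`: continuous cocycles, i.e. translation parts of the continuous affine actions with
linear part `π`. -/
def Z1 (ρ : BanachRep.{u, v} G) : Submodule ℂ (G → ρ.E) where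
  carrier := {b | Continuous b ∧ ∀ g h, b (g * h) = b g + ρ.π g (b h)}
  add_mem' := by
    rintro b c ⟨hb, hb'⟩ ⟨hc, hc'⟩
    refine ⟨hb.add hc, fun g h => ?_⟩
    simp only [Pi.add_apply, hb' g h, hc' g h, map_add]
    abel
  zero_mem' := ⟨continuous_const, fun g h => by simp⟩
  smul_mem' := by
    rintro a b ⟨hb, hb'⟩
    refine ⟨hb.const_smul a, fun g h => ?_⟩
    simp only [Pi.smul_apply, hb' g h, map_smul, smul_add]

/-- `B¹(G, π)`: the cocycles `g ↦ x - π(g) x`. -/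
def B1 (ρ : BanachRep.{u, v} G) : Submodule ℂ (G → ρ.E) where
  carrier := {b | ∃ x : ρ.E, ∀ g, b g = x - ρ.π g x}
  add_mem' := by
    rintro b c ⟨x, hx⟩ ⟨y, hy⟩
    refine ⟨x + y, fun g => ?_⟩
    simp only [Pi.add_apply, hx g, hy g, map_add]
    abel
  zero_mem' := ⟨0, fun g => by simp⟩
  smul_mem' := by
    rintro a b ⟨x, hx⟩
    refine ⟨a • x, fun g => ?_⟩
    simp only [Pi.smul_apply, hx g, map_smul, smul_sub]

/-- `H¹(G, π) = Z¹(G, π) / B¹(G, π)`. -/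
abbrev H1 (ρ : BanachRep.{u, v} G) : Type (max u v) :=
  ρ.Z1 ⧸ ρ.B1.submoduleOf ρ.Z1

theorem exists_bound_on_compact (ρ : BanachRep.{u, v} G) {K : Set G} (hK : IsCompact K) :
    ∃ C, ∀ g ∈ K, ‖ρ.π g‖ ≤ C := by
  obtain ⟨C, hC⟩ := banach_steinhaus (g := fun g : K => ρ.π g) (fun x => by
    obtain ⟨C, hC⟩ := hK.exists_bound_of_continuousOn (ρ.continuous_apply x).continuousOn
    exact ⟨C, fun g => hC g g.2⟩)
  exact ⟨C, fun g hg => hC ⟨g, hg⟩⟩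

end Basic

section Operators

set_option linter.unusedSectionVars false

variable {G : Type u} [Group G] [TopologicalSpace G] [IsTopologicalGroup G]
  [MeasurableSpace G] [BorelSpace G] (μ : Measure G) [μ.IsHaarMeasure]

theorem integrable_smul (ρ : BanachRep.{u, v} G) (f : C_c(G, ℂ)) (x : ρ.E) :
    Integrable (fun g => f g • ρ.π g x) μ :=
  (f.continuous.smul (ρ.continuous_apply x)).integrable_of_hasCompactSupport
    f.hasCompactSupport.smul_right

theorem norm_integral_le (ρ : BanachRep.{u, v} G) (f : C_c(G, ℂ)) {C : ℝ}
    (hC : ∀ g ∈ tsupport f, ‖ρ.π g‖ ≤ C) (x : ρ.E) :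
    ‖∫ g, f g • ρ.π g x ∂μ‖ ≤ ((∫ g, ‖f g‖ ∂μ) * C) * ‖x‖ := by
  have hf : Integrable (fun g => ‖f g‖) μ :=
    (f.continuous.integrable_of_hasCompactSupport f.hasCompactSupport).norm
  rw [mul_assoc, ← integral_mul_const]
  refine norm_integral_le_of_norm_le (hf.mul_const _) (Filter.Eventually.of_forall fun g => ?_)
  rw [norm_smul]
  by_cases hg : g ∈ tsupport f
  · exact mul_le_mul_of_nonneg_left
      ((ρ.π g).le_of_opNorm_le (hC g hg) x) (norm_nonneg _)
  · simp [image_eq_zero_of_notMem_tsupport hg]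

/-- The operator `π(f) : x ↦ ∫ f(g) π(g) x dg`. -/
def op (ρ : BanachRep.{u, v} G) (f : C_c(G, ℂ)) : ρ.E →L[ℂ] ρ.E :=
  LinearMap.mkContinuousOfExistsBound
    { toFun := fun x => ∫ g, f g • ρ.π g x ∂μ
      map_add' := fun x y => by
        simp only [map_add, smul_add]
        exact integral_add (ρ.integrable_smul μ f x) (ρ.integrable_smul μ f y)
      map_smul' := fun c x => by
        simp only [map_smul, RingHom.id_apply]
        rw [← integral_smul]
        exact integral_congr_ae (Filter.Eventually.of_forall fun g => smul_comm _ _ _) }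
    (by
      obtain ⟨C, hC⟩ := ρ.exists_bound_on_compact f.hasCompactSupport
      exact ⟨_, ρ.norm_integral_le μ f hC⟩)

theorem op_apply (ρ : BanachRep.{u, v} G) (f : C_c(G, ℂ)) (x : ρ.E) :
    ρ.op μ f x = ∫ g, f g • ρ.π g x ∂μ := rfl

theorem op_add (ρ : BanachRep.{u, v} G) (f₁ f₂ : C_c(G, ℂ)) :
    ρ.op μ (f₁ + f₂) = ρ.op μ f₁ + ρ.op μ f₂ := by
  ext x
  simp only [op_apply, _root_.add_apply, CompactlySupportedContinuousMap.add_apply,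
    add_smul]
  exact integral_add (ρ.integrable_smul μ f₁ x) (ρ.integrable_smul μ f₂ x)

theorem op_smul (ρ : BanachRep.{u, v} G) (c : ℂ) (f : C_c(G, ℂ)) :
    ρ.op μ (c • f) = c • ρ.op μ f := by
  ext x
  simp only [op_apply, _root_.smul_apply, CompactlySupportedContinuousMap.smul_apply,
    smul_assoc]
  exact integral_smul _ _

theorem norm_op_le (ρ : BanachRep.{u, v} G) (f : C_c(G, ℂ)) {C : ℝ} (hC0 : 0 ≤ C)
    (hC : ∀ g ∈ tsupport f, ‖ρ.π g‖ ≤ C) : ‖ρ.op μ f‖ ≤ (∫ g, ‖f g‖ ∂μ) * C :=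
  ContinuousLinearMap.opNorm_le_bound _
    (mul_nonneg (integral_nonneg fun _ => norm_nonneg _) hC0) (ρ.norm_integral_le μ f hC)

/-- Convolution `(f₁ * f₂)(g) = ∫ f₁(h) f₂(h⁻¹ g) dh` on `C_c(G)`. -/
def conv (f₁ f₂ : C_c(G, ℂ)) : C_c(G, ℂ) where
  toFun := fun g => ∫ h, f₁ h * f₂ (h⁻¹ * g) ∂μ
  continuous_toFun := by
    rw [← continuousOn_univ]
    refine continuousOn_integral_of_compact_support (k := tsupport f₁) f₁.hasCompactSupport ?_ ?_
    · exact Continuous.continuousOn (by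
        have h1 := f₁.continuous
        have h2 := f₂.continuous
        fun_prop)
    · intro p x _ hx
      simp [image_eq_zero_of_notMem_tsupport hx]
  hasCompactSupport' := by
    have hK : IsCompact (tsupport f₁ * tsupport f₂) :=
      f₁.hasCompactSupport.isCompact.mul f₂.hasCompactSupport.isCompact
    refine HasCompactSupport.intro' hK.closure isClosed_closure fun g hg => ?_
    have : ∀ h, f₁ h * f₂ (h⁻¹ * g) = 0 := by
      intro h
      by_contra hne
      have h1 : h ∈ tsupport f₁ := by
        by_contra h1
        exact hne (by simp [image_eq_zero_of_notMem_tsupport h1])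
      have h2 : h⁻¹ * g ∈ tsupport f₂ := by
        by_contra h2
        exact hne (by simp [image_eq_zero_of_notMem_tsupport h2])
      exact hg (subset_closure ⟨h, h1, h⁻¹ * g, h2, by simp⟩)
    simp [this]

theorem conv_apply (f₁ f₂ : C_c(G, ℂ)) (g : G) :
    conv μ f₁ f₂ g = ∫ h, f₁ h * f₂ (h⁻¹ * g) ∂μ := rfl

theorem integrable_conv (f₁ f₂ : C_c(G, ℂ)) (g : G) :
    Integrable (fun h => f₁ h * f₂ (h⁻¹ * g)) μ := by
  have h1 := f₁.continuous
  have h2 := f₂.continuous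
  exact Continuous.integrable_of_hasCompactSupport (by fun_prop) f₁.hasCompactSupport.mul_right

theorem conv_add_left (f₁ f₁' f₂ : C_c(G, ℂ)) :
    conv μ (f₁ + f₁') f₂ = conv μ f₁ f₂ + conv μ f₁' f₂ := by
  ext g
  simp only [conv_apply, CompactlySupportedContinuousMap.add_apply, add_mul]
  exact integral_add (integrable_conv μ _ _ g) (integrable_conv μ _ _ g)

theorem conv_add_right (f₁ f₂ f₂' : C_c(G, ℂ)) :
    conv μ f₁ (f₂ + f₂') = conv μ f₁ f₂ + conv μ f₁ f₂' := by
  ext g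
  simp only [conv_apply, CompactlySupportedContinuousMap.add_apply, mul_add]
  exact integral_add (integrable_conv μ _ _ g) (integrable_conv μ _ _ g)

theorem conv_smul_left (c : ℂ) (f₁ f₂ : C_c(G, ℂ)) :
    conv μ (c • f₁) f₂ = c • conv μ f₁ f₂ := by
  ext g
  simp only [conv_apply, CompactlySupportedContinuousMap.smul_apply, smul_eq_mul, mul_assoc]
  exact integral_const_mul _ _

theorem conv_smul_right (c : ℂ) (f₁ f₂ : C_c(G, ℂ)) :
    conv μ f₁ (c • f₂) = c • conv μ f₁ f₂ := by
  ext g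
  simp only [conv_apply, CompactlySupportedContinuousMap.smul_apply, smul_eq_mul, mul_left_comm]
  exact integral_const_mul _ _

theorem op_conv (ρ : BanachRep.{u, v} G) (f₁ f₂ : C_c(G, ℂ)) :
    ρ.op μ (conv μ f₁ f₂) = (ρ.op μ f₁).comp (ρ.op μ f₂) := by
  ext x
  have hswap : ∫ h, (∫ g, (f₁ h * f₂ (h⁻¹ * g)) • ρ.π g x ∂μ) ∂μ
      = ∫ g, (∫ h, (f₁ h * f₂ (h⁻¹ * g)) • ρ.π g x ∂μ) ∂μ := by
    apply integral_integral_swap_of_hasCompactSupport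
    · have h1 := f₁.continuous
      have h2 := f₂.continuous
      have h3 := ρ.continuous_apply x
      exact Continuous.smul (by fun_prop) (h3.comp continuous_snd)
    · have hK : IsCompact (tsupport f₁ * tsupport f₂) :=
        f₁.hasCompactSupport.isCompact.mul f₂.hasCompactSupport.isCompact
      refine HasCompactSupport.intro' (f₁.hasCompactSupport.isCompact.prod hK.closure)
        ((isClosed_tsupport _).prod isClosed_closure) ?_
      rintro ⟨h, g⟩ hg
      by_cases h1 : h ∈ tsupport f₁
      · by_cases h2 : h⁻¹ * g ∈ tsupport f₂
        · exact absurd ⟨h1, subset_closure ⟨h, h1, h⁻¹ * g, h2, by simp⟩⟩ hg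
        · simp [image_eq_zero_of_notMem_tsupport h2]
      · simp [image_eq_zero_of_notMem_tsupport h1]
  have hL : ∀ h, f₁ h • ρ.π h (∫ g, f₂ g • ρ.π g x ∂μ)
      = ∫ g, (f₁ h * f₂ (h⁻¹ * g)) • ρ.π g x ∂μ := by
    intro h
    rw [← (ρ.π h).integral_comp_comm (ρ.integrable_smul μ f₂ x), ← integral_smul,
      ← integral_mul_left_eq_self (fun g => (f₁ h * f₂ (h⁻¹ * g)) • ρ.π g x) h]
    refine integral_congr_ae (Filter.Eventually.of_forall fun g => ?_)
    simp [mul_smul]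
  have hR : ∀ g, (∫ h, f₁ h * f₂ (h⁻¹ * g) ∂μ) • ρ.π g x
      = ∫ h, (f₁ h * f₂ (h⁻¹ * g)) • ρ.π g x ∂μ := fun g => (integral_smul_const _ _).symm
  simp only [ContinuousLinearMap.comp_apply, op_apply, conv_apply, hL, hR]
  exact hswap.symm

end Operators

/-- The family `F` is uniformly bounded on compact subsets of `G`. -/
def BddOnCompacts {G : Type u} [Group G] [TopologicalSpace G] (F : Set (BanachRep.{u, v} G)) :
    Prop :=
  ∀ K : Set G, IsCompact K → ∃ C : ℝ, ∀ ρ ∈ F, ∀ g ∈ K, ‖ρ.π g‖ ≤ C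

section Algebra

variable {G : Type u} [Group G] [TopologicalSpace G] [IsTopologicalGroup G]
  [MeasurableSpace G] [BorelSpace G] (μ : Measure G) [μ.IsHaarMeasure]

/-- `‖f‖_F = sup {‖π(f)‖ : (π, E) ∈ F}`. -/
def normF (F : Set (BanachRep.{u, v} G)) (f : C_c(G, ℂ)) : ℝ :=
  sSup {r | ∃ ρ ∈ F, r = ‖ρ.op μ f‖}

theorem bddAbove_normF {F : Set (BanachRep.{u, v} G)} (hF : BddOnCompacts F) (f : C_c(G, ℂ)) :
    BddAbove {r | ∃ ρ ∈ F, r = ‖ρ.op μ f‖} := by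
  obtain ⟨C, hC⟩ := hF _ f.hasCompactSupport
  refine ⟨(∫ g, ‖f g‖ ∂μ) * max C 0, ?_⟩
  rintro r ⟨ρ, hρ, rfl⟩
  exact ρ.norm_op_le μ f (le_max_right _ _) fun g hg => (hC ρ hρ g hg).trans (le_max_left _ _)

theorem norm_op_le_normF {F : Set (BanachRep.{u, v} G)} (hF : BddOnCompacts F)
    {ρ : BanachRep.{u, v} G} (hρ : ρ ∈ F) (f : C_c(G, ℂ)) : ‖ρ.op μ f‖ ≤ normF μ F f :=
  le_csSup (bddAbove_normF μ hF f) ⟨ρ, hρ, rfl⟩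

theorem normF_nonneg (F : Set (BanachRep.{u, v} G)) (f : C_c(G, ℂ)) : 0 ≤ normF μ F f := by
  apply Real.sSup_nonneg
  rintro r ⟨ρ, -, rfl⟩
  exact norm_nonneg _

theorem normF_le {F : Set (BanachRep.{u, v} G)} {f : C_c(G, ℂ)} {C : ℝ} (hC : 0 ≤ C)
    (h : ∀ ρ ∈ F, ‖ρ.op μ f‖ ≤ C) : normF μ F f ≤ C := by
  apply Real.sSup_le _ hC
  rintro r ⟨ρ, hρ, rfl⟩
  exact h ρ hρ

theorem normF_add_le {F : Set (BanachRep.{u, v} G)} (hF : BddOnCompacts F) (f₁ f₂ : C_c(G, ℂ)) :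
    normF μ F (f₁ + f₂) ≤ normF μ F f₁ + normF μ F f₂ := by
  refine normF_le μ (add_nonneg (normF_nonneg μ F _) (normF_nonneg μ F _)) fun ρ hρ => ?_
  rw [op_add]
  exact (norm_add_le _ _).trans
    (add_le_add (norm_op_le_normF μ hF hρ _) (norm_op_le_normF μ hF hρ _))

theorem normF_smul {F : Set (BanachRep.{u, v} G)} (hF : BddOnCompacts F) (c : ℂ)
    (f : C_c(G, ℂ)) : normF μ F (c • f) = ‖c‖ * normF μ F f := by
  have key : ∀ (c : ℂ) (f : C_c(G, ℂ)), normF μ F (c • f) ≤ ‖c‖ * normF μ F f := fun c f =>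
    normF_le μ (mul_nonneg (norm_nonneg _) (normF_nonneg μ F f)) fun ρ hρ => by
      rw [op_smul, norm_smul]
      exact mul_le_mul_of_nonneg_left (norm_op_le_normF μ hF hρ f) (norm_nonneg _)
  refine le_antisymm (key c f) ?_
  rcases eq_or_ne c 0 with rfl | hc
  · simpa using normF_nonneg μ F _
  · have h := key c⁻¹ (c • f)
    rw [smul_smul, inv_mul_cancel₀ hc, one_smul, norm_inv] at h
    rwa [← div_eq_inv_mul, le_div_iff₀' (norm_pos_iff.2 hc)] at h

theorem normF_conv_le {F : Set (BanachRep.{u, v} G)} (hF : BddOnCompacts F)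
    (f₁ f₂ : C_c(G, ℂ)) : normF μ F (conv μ f₁ f₂) ≤ normF μ F f₁ * normF μ F f₂ := by
  refine normF_le μ (mul_nonneg (normF_nonneg μ F _) (normF_nonneg μ F _)) fun ρ hρ => ?_
  rw [op_conv]
  exact (ContinuousLinearMap.opNorm_comp_le _ _).trans
    (mul_le_mul (norm_op_le_normF μ hF hρ _) (norm_op_le_normF μ hF hρ _) (norm_nonneg _)
      (normF_nonneg μ F _))

/-- The space `C_c(G)`, to be equipped with the seminorm `‖·‖_F`. -/
def CcF (F : Set (BanachRep.{u, v} G)) (_ : BddOnCompacts F) (_ : Measure G) : Type u := C_c(G, ℂ)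

variable {F : Set (BanachRep.{u, v} G)} {hF : BddOnCompacts F}

instance : AddCommGroup (CcF F hF μ) := inferInstanceAs (AddCommGroup C_c(G, ℂ))

instance : Module ℂ (CcF F hF μ) := inferInstanceAs (Module ℂ C_c(G, ℂ))

instance : Norm (CcF F hF μ) := ⟨normF μ F⟩

theorem ccF_core : SeminormedSpace.Core ℂ (CcF F hF μ) where
  norm_nonneg f := normF_nonneg μ F f
  norm_smul c f := normF_smul μ hF c f
  norm_triangle f₁ f₂ := normF_add_le μ hF f₁ f₂

instance : SeminormedAddCommGroup (CcF F hF μ) := SeminormedAddCommGroup.ofCore (ccF_core μ)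

instance : NormedSpace ℂ (CcF F hF μ) where
  norm_smul_le c f := ((ccF_core μ).norm_smul c f).le

variable (F hF)

/-- `C_F(G)`: the completion of `C_c(G)` for `‖·‖_F`. -/
abbrev CF : Type u := Completion (CcF F hF μ)

/-- The canonical map `C_c(G) → C_F(G)`. -/
def toCF (f : C_c(G, ℂ)) : CF μ F hF := ((show CcF F hF μ from f : CcF F hF μ) : CF μ F hF)

variable {F hF}

/-- The convolution product of `C_F(G)`: the continuous extension of convolution on `C_c(G)`. -/
instance : Mul (CF μ F hF) :=
  ⟨Function.curry <|
    ((Completion.isDenseInducing_coe (α := CcF F hF μ)).prodMap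
      (Completion.isDenseInducing_coe (α := CcF F hF μ))).extend
        fun p : CcF F hF μ × CcF F hF μ => toCF μ F hF (conv μ p.1 p.2)⟩

/-- Convolution on `(C_c(G), ‖·‖_F)` as a bounded bilinear map. -/
def convL : CcF F hF μ →L[ℂ] CcF F hF μ →L[ℂ] CcF F hF μ :=
  LinearMap.mkContinuous₂
    (LinearMap.mk₂ ℂ (M := C_c(G, ℂ)) (Nₗ := C_c(G, ℂ)) (Pₗ := C_c(G, ℂ)) (conv μ)
      (conv_add_left μ) (conv_smul_left μ) (conv_add_right μ) (conv_smul_right μ)) 1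
    (fun f₁ f₂ => by
      rw [one_mul]
      exact normF_conv_le μ hF f₁ f₂)

theorem continuous_convL :
    Continuous fun p : CcF F hF μ × CcF F hF μ => toCF μ F hF (conv μ p.1 p.2) :=
  (Completion.continuous_coe _).comp (convL (F := F) (hF := hF) μ).continuous₂

theorem toCF_mul (f₁ f₂ : C_c(G, ℂ)) :
    toCF μ F hF f₁ * toCF μ F hF f₂ = toCF μ F hF (conv μ f₁ f₂) :=
  ((Completion.isDenseInducing_coe (α := CcF F hF μ)).prodMap
      (Completion.isDenseInducing_coe (α := CcF F hF μ))).extend_eq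
    (continuous_convL μ) (f₁, f₂)

theorem continuous_mul_CF : Continuous fun p : CF μ F hF × CF μ F hF => p.1 * p.2 := by
  have di : IsDenseInducing (Completion.toCompl : CcF F hF μ → CF μ F hF) :=
    Completion.isDenseInducing_coe
  let φ : CcF F hF μ →+ CcF F hF μ →+ CF μ F hF :=
    AddMonoidHom.mk' (fun f₁ => (Completion.toCompl).comp (convL μ f₁).toLinearMap.toAddMonoidHom)
      (fun f₁ f₂ => by
        ext f
        simp [Completion.coe_add])
  have hφ : Continuous fun p : CcF F hF μ × CcF F hF μ => φ p.1 p.2 := continuous_convL μ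
  exact (di.extend_Z_bilin di hφ :)

/-- `f ↦ π(f)` on `(C_c(G), ‖·‖_F)`, for `(π, E) ∈ F`. -/
def opL {ρ : BanachRep.{u, v} G} (hρ : ρ ∈ F) : CcF F hF μ →L[ℂ] (ρ.E →L[ℂ] ρ.E) :=
  LinearMap.mkContinuous
    { toFun := fun f => ρ.op μ f
      map_add' := ρ.op_add μ
      map_smul' := ρ.op_smul μ } 1
    (fun f => (norm_op_le_normF μ hF hρ f).trans (one_mul _).ge)

/-- The extension of `π` to `C_F(G)`, for `(π, E) ∈ F`. -/
def ext {ρ : BanachRep.{u, v} G} (hρ : ρ ∈ F) : CF μ F hF →L[ℂ] (ρ.E →L[ℂ] ρ.E) :=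
  (opL (hF := hF) μ hρ).extend Completion.toComplL

theorem ext_toCF {ρ : BanachRep.{u, v} G} (hρ : ρ ∈ F) (f : C_c(G, ℂ)) :
    ext μ hρ (toCF μ F hF f) = ρ.op μ f :=
  (opL (hF := hF) μ hρ).extend_eq (e := Completion.toComplL) Completion.denseRange_coe
    (Completion.isUniformInducing_coe _) _

/-- Kazhdan projections in `C_F(G)`: idempotents in the closure of `{f ∈ C_c(G), ∫ f = 1}` acting
as a projection onto `E^π` for every `(π, E) ∈ F`. -/
structure IsKazhdanProjection (p : CF μ F hF) : Prop where
  idempotent : IsIdempotentElem p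
  mem_closure : p ∈ closure (toCF μ F hF '' {f | ∫ g, f g ∂μ = 1})
  isProj : ∀ (ρ : BanachRep.{u, v} G) (hρ : ρ ∈ F), LinearMap.IsProj ρ.invariants (ext μ hρ p)

variable (F) in
/-- `C_F(G)` is defined, i.e. `F` is uniformly bounded on compact sets, and it has a Kazhdan
projection. -/
def HasKazhdanProjection : Prop :=
  ∃ (hF : BddOnCompacts F) (p : CF μ F hF), IsKazhdanProjection μ p

end Algebra

section RepSpace

variable {G : Type u} [Group G] [TopologicalSpace G]

/-- Representations on separable Banach spaces with `‖π(g)‖ ≤ M` for all `g ∈ S`. -/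
def Rep (S : Set G) (M : ℝ) : Type (max u (v + 1)) :=
  {ρ : BanachRep.{u, v} G // TopologicalSpace.SeparableSpace ρ.E ∧ ∀ g ∈ S, ‖ρ.π g‖ ≤ M}

/-- Equivalence of representations. -/
instance repSetoid (S : Set G) (M : ℝ) : Setoid (Rep.{u, v} S M) where
  r ρ₁ ρ₂ := Equivalent ρ₁.1 ρ₂.1
  iseqv :=
    { refl := fun ρ => ⟨LinearIsometryEquiv.refl ℂ _, fun _ _ => rfl⟩
      symm := by
        rintro ρ₁ ρ₂ ⟨T, hT⟩
        refine ⟨T.symm, fun g x => ?_⟩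
        rw [LinearIsometryEquiv.symm_apply_eq, hT, LinearIsometryEquiv.apply_symm_apply]
      trans := by
        rintro ρ₁ ρ₂ ρ₃ ⟨T, hT⟩ ⟨T', hT'⟩
        refine ⟨T.trans T', fun g x => ?_⟩
        simp only [LinearIsometryEquiv.trans_apply, hT, hT'] }

/-- The space `R` of equivalence classes of representations of `G` on separable Banach spaces with
`‖π(g)‖ ≤ M` for all `g ∈ S`. -/
def RepSpace (S : Set G) (M : ℝ) : Type (max u (v + 1)) := Quotient (repSetoid.{u, v} S M)

/-- The equivalence class of a representation. -/
def Rep.cls {S : Set G} {M : ℝ} (ρ : Rep.{u, v} S M) : RepSpace.{u, v} S M :=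
  Quotient.mk (repSetoid.{u, v} S M) ρ

/-- All the representations whose class belongs to `F`. -/
def RepSpace.reps {S : Set G} {M : ℝ} (F : Set (RepSpace.{u, v} S M)) :
    Set (BanachRep.{u, v} G) :=
  {ρ | ∃ ρ' : Rep.{u, v} S M, ρ'.1 = ρ ∧ ρ'.cls ∈ F}

variable [IsTopologicalGroup G] [MeasurableSpace G] [BorelSpace G]
  (μ : Measure G) [μ.IsHaarMeasure]

/-- `IsClose μ ρ x Q ε ρ'` : for suitable vectors `x'₁, …, x'ₙ` of `ρ'`, the supremum of
`|‖∑ π'(f_k) x'_k‖ - ‖∑ π(f_k) x_k‖|` over all `f₁, …, fₙ ∈ C_c(G)` supported in `Q` with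
`‖f_k‖_{L₁} ≤ 1` is `< ε`. -/
def IsClose (ρ : BanachRep.{u, v} G) {n : ℕ} (x : Fin n → ρ.E) (Q : Set G) (ε : ℝ)
    (ρ' : BanachRep.{u, v} G) : Prop :=
  ∃ x' : Fin n → ρ'.E, ∃ δ < ε, ∀ f : Fin n → C_c(G, ℂ),
    (∀ k, tsupport (f k) ⊆ Q ∧ ∫ g, ‖f k g‖ ∂μ ≤ 1) →
      |‖∑ k, ρ'.op μ (f k) (x' k)‖ - ‖∑ k, ρ.op μ (f k) (x k)‖| ≤ δ

/-- The basic open set `W_{x₁,…,xₙ,Q,ε}(π, E)` of `R`. -/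
def W {S : Set G} {M : ℝ} (ρ : Rep.{u, v} S M) {n : ℕ} (x : Fin n → ρ.1.E) (Q : Set G) (ε : ℝ) :
    Set (RepSpace.{u, v} S M) :=
  {c | ∃ ρ' : Rep.{u, v} S M, ρ'.cls = c ∧ IsClose μ ρ.1 x Q ε ρ'.1}

/-- The Fell-like topology on `R`, with basis the sets `W_{x₁,…,xₙ,Q,ε}(π, E)`. -/
@[reducible] def fellTopology (S : Set G) (M : ℝ) : TopologicalSpace (RepSpace.{u, v} S M) :=
  TopologicalSpace.generateFrom
    {V | ∃ (ρ : Rep.{u, v} S M) (n : ℕ) (x : Fin n → ρ.1.E) (Q : Set G) (ε : ℝ),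
      IsCompact Q ∧ 0 < ε ∧ V = W μ ρ x Q ε}

end RepSpace

end BanachRep

/-- `B` is a strong neighbourhood of `A`: `B` belongs to every ultrafilter all of whose accumulation
points are in `A`. -/
def IsStrongNhd {X : Type*} (t : TopologicalSpace X) (B A : Set X) : Prop :=
  ∀ 𝒰 : Ultrafilter X, (∀ x, @ClusterPt X t x (𝒰 : Filter X) → x ∈ A) → B ∈ 𝒰

end

/-! ### Compact generation -/

namespace BanachRep

/-! A cocycle `b` for `π` is an affine action `σ(g) x = π(g) x + b(g)`; a function `m` of integral 1
acts by averaging, with `σ(m) 0 = ∫ m b`. The displacement of a point `x` is the supremum over `S`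
of `‖σ(s) x - x‖`. Both hypotheses on a family are captured by one quantitative condition,
`Contracts`: `σ(m)` multiplies displacement by at most some `κ < 1`, uniformly over all affine
actions whose linear part lies in the family.

If there is a Kazhdan projection `p` and `H¹` vanishes, every `σ` has a fixed point, at a distance
from the origin controlled by the displacement, and `m` close to `p` sends the origin close to a
fixed point. So any `κ > 0` can be reached (`HasKazhdanProjection.exists_contracts`). Conversely,
iterating `σ(m)` gives a Cauchy sequence tending to a fixed point (`Contracts.subsingleton_H1`), and
for linear actions the convolution powers of `m` converge to a Kazhdan projection
(`hasKazhdanProjection_of_contracts`).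

It remains to see that contraction persists on a strong neighbourhood (`isStrongNhd_contracts`).
Otherwise some ultrafilter with all its accumulation points in `F` contains the set of classes
having an affine action that violates contraction. Moving the base point to `σ(f) 0` makes the orbit
maps equicontinuous, so the ultralimit of these affine actions, on the space generated by the values
of the limit cocycle, is strongly continuous and separable (`exists_ultralimit_rep`). Its linear
part is an accumulation point of the ultrafilter (`eventually_isClose`, `clusterPt_fellTopology`),
hence lies in `F`, where `m` contracts. This estimate passes back to the family
(`eventually_displacement_le`), a contradiction. The smoothing costs a constant factor `C` in
displacement, absorbed by choosing `κ` small compared with `1 / C`. -/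

theorem exists_subset_pow_of_isCompact {G : Type u} [Group G] [TopologicalSpace G]
    [IsTopologicalGroup G] [T2Space G] [LocallyCompactSpace G] {S : Set G}
    (hS : IsCompact S) (hS_symm : S⁻¹ = S) (hS_one : (1 : G) ∈ S)
    (hS_gen : Subgroup.closure S = ⊤) {K : Set G} (hK : IsCompact K) : ∃ n : ℕ, K ⊆ S ^ n := by
  have hpow : ∀ n : ℕ, IsCompact (S ^ n) := by
    intro n
    induction n with
    | zero => rw [pow_zero]; exact isCompact_singleton
    | succ n ih => rw [pow_succ]; exact ih.mul hS
  have hmono : Monotone fun n : ℕ => S ^ n := fun a b hab => Set.pow_subset_pow_right hS_one hab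
  have hinv : ∀ n : ℕ, (S ^ n)⁻¹ = S ^ n := fun n => by rw [← inv_pow, hS_symm]
  have hcover : ∀ g : G, ∃ n : ℕ, g ∈ S ^ n := by
    intro g
    have hg : g ∈ Subgroup.closure S := by rw [hS_gen]; trivial
    induction hg using Subgroup.closure_induction with
    | mem x hx => exact ⟨1, by rwa [pow_one]⟩
    | one => exact ⟨0, by simp⟩
    | mul x y _ _ hx hy =>
      obtain ⟨a, ha⟩ := hx
      obtain ⟨b, hb⟩ := hy
      exact ⟨a + b, by rw [pow_add]; exact Set.mul_mem_mul ha hb⟩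
    | inv x _ hx =>
      obtain ⟨a, ha⟩ := hx
      exact ⟨a, by rw [← hinv a]; exact Set.inv_mem_inv.2 ha⟩
  -- Baire: one of the countably many compact powers covering `G` has an interior point `x`;
  -- translating by `x⁻¹ ∈ S ^ n` then makes `S ^ (n + n)` a neighbourhood of `1`.
  obtain ⟨n, x, hx⟩ := nonempty_interior_of_iUnion_of_closed (fun n : ℕ => (hpow n).isClosed)
    (Set.iUnion_eq_univ_iff.2 hcover)
  have hn1 : S ^ (n + n) ∈ 𝓝 (1 : G) := by
    have h1 : (fun y => x * y) ⁻¹' (S ^ n) ∈ 𝓝 (1 : G) := by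
      refine (continuous_const_mul x).continuousAt.preimage_mem_nhds ?_
      rw [mul_one]
      exact mem_interior_iff_mem_nhds.1 hx
    filter_upwards [h1] with y hy
    rw [pow_add]
    refine ⟨x⁻¹, ?_, x * y, hy, by simp⟩
    rw [← hinv n]
    exact Set.inv_mem_inv.2 (interior_subset hx)
  have hcov : K ⊆ ⋃ k : ℕ, interior (S ^ k) := by
    intro g _
    obtain ⟨k, hk⟩ := hcover g
    refine Set.mem_iUnion.2 ⟨k + (n + n), mem_interior_iff_mem_nhds.2 ?_⟩
    have h1 : (fun y => g⁻¹ * y) ⁻¹' (S ^ (n + n)) ∈ 𝓝 g := by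
      refine (continuous_const_mul g⁻¹).continuousAt.preimage_mem_nhds ?_
      rwa [inv_mul_cancel]
    filter_upwards [h1] with y hy
    rw [pow_add]
    exact ⟨g, hk, g⁻¹ * y, hy, by simp⟩
  obtain ⟨k, hk⟩ := hK.elim_directed_cover _ (fun k => isOpen_interior) hcov
    (Monotone.directed_le fun a b hab => interior_mono (hmono hab))
  exact ⟨k, hk.trans interior_subset⟩

/-! ### Integrals against compactly supported functions -/

section Integrals

variable {G : Type u} [TopologicalSpace G] [MeasurableSpace G] [BorelSpace G]
  (μ : Measure G) [IsFiniteMeasureOnCompacts μ]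

theorem integrable_smul_of_continuous {E : Type v} [NormedAddCommGroup E] [NormedSpace ℂ E]
    (f : C_c(G, ℂ)) {φ : G → E} (hφ : Continuous φ) : Integrable (fun g => f g • φ g) μ :=
  (f.continuous.smul hφ).integrable_of_hasCompactSupport f.hasCompactSupport.smul_right

theorem integrable_Cc (f : C_c(G, ℂ)) : Integrable (fun g => f g) μ :=
  f.continuous.integrable_of_hasCompactSupport f.hasCompactSupport

theorem norm_integral_smul_le {E : Type v} [NormedAddCommGroup E] [NormedSpace ℂ E]
    (f : C_c(G, ℂ)) {φ : G → E} {C : ℝ} (hC : ∀ g ∈ tsupport f, ‖φ g‖ ≤ C) :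
    ‖∫ g, f g • φ g ∂μ‖ ≤ (∫ g, ‖f g‖ ∂μ) * C := by
  rw [← integral_mul_const]
  refine norm_integral_le_of_norm_le ((integrable_Cc μ f).norm.mul_const _)
    (Filter.Eventually.of_forall fun g => ?_)
  rw [norm_smul]
  by_cases hg : g ∈ tsupport f
  · exact mul_le_mul_of_nonneg_left (hC g hg) (norm_nonneg _)
  · simp [image_eq_zero_of_notMem_tsupport hg]

end Integrals

/-! ### Uniform growth of representations and cocycles -/

section Bounds

variable {G : Type u} [Group G] [TopologicalSpace G]

theorem norm_one_le (ρ : BanachRep.{u, v} G) : ‖ρ.π 1‖ ≤ 1 := by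
  rw [map_one]
  exact ContinuousLinearMap.norm_id_le

theorem norm_le_pow_of_mem_pow {S : Set G} {M : ℝ} (hM : 1 ≤ M) (ρ : BanachRep.{u, v} G)
    (hρ : ∀ g ∈ S, ‖ρ.π g‖ ≤ M) (n : ℕ) : ∀ g ∈ S ^ n, ‖ρ.π g‖ ≤ M ^ n := by
  induction n with
  | zero =>
    intro g hg
    rw [pow_zero, Set.mem_one] at hg
    rw [hg, pow_zero]
    exact ρ.norm_one_le
  | succ n ih =>
    intro g hg
    rw [pow_succ] at hg
    obtain ⟨a, ha, s, hs, rfl⟩ := hg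
    simp only [map_mul]
    rw [pow_succ]
    exact (norm_mul_le _ _).trans
      (mul_le_mul (ih a ha) (hρ s hs) (norm_nonneg _) (by positivity))

theorem cocycle_one (ρ : BanachRep.{u, v} G) {b : G → ρ.E} (hb : b ∈ ρ.Z1) : b 1 = 0 := by
  have h := hb.2 1 1
  rw [mul_one, map_one] at h
  simpa using h

theorem norm_cocycle_le_of_mem_pow {S : Set G} {M : ℝ} (hM : 1 ≤ M) (ρ : BanachRep.{u, v} G)
    (hρ : ∀ g ∈ S, ‖ρ.π g‖ ≤ M) {b : G → ρ.E} (hb : b ∈ ρ.Z1) {D : ℝ} (hD : 0 ≤ D)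
    (hbD : ∀ s ∈ S, ‖b s‖ ≤ D) (n : ℕ) : ∀ g ∈ S ^ n, ‖b g‖ ≤ n * M ^ n * D := by
  induction n with
  | zero =>
    intro g hg
    rw [pow_zero, Set.mem_one] at hg
    simp [hg, ρ.cocycle_one hb]
  | succ n ih =>
    intro g hg
    rw [pow_succ] at hg
    obtain ⟨a, ha, s, hs, rfl⟩ := hg
    have h1 : ‖ρ.π a (b s)‖ ≤ M ^ n * D :=
      (ρ.π a).le_of_opNorm_le_of_le (ρ.norm_le_pow_of_mem_pow hM hρ n a ha) (hbD s hs)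
    have h2 : M ^ n ≤ M ^ (n + 1) := pow_le_pow_right₀ hM (Nat.le_succ n)
    calc ‖b (a * s)‖ ≤ ‖b a‖ + ‖ρ.π a (b s)‖ := by rw [hb.2]; exact norm_add_le _ _
      _ ≤ n * M ^ n * D + M ^ n * D := add_le_add (ih a ha) h1
      _ = (n + 1) * D * M ^ n := by ring
      _ ≤ (n + 1) * D * M ^ (n + 1) := by gcongr
      _ = ((n + 1 : ℕ) : ℝ) * M ^ (n + 1) * D := by push_cast; ring

theorem coboundary_mem_Z1 (ρ : BanachRep.{u, v} G) (x : ρ.E) :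
    (fun g => x - ρ.π g x) ∈ ρ.Z1 := by
  refine ⟨continuous_const.sub (ρ.continuous_apply x), fun g h => ?_⟩
  simp only [map_mul, map_sub, mul_apply_eq_comp]
  abel

/-- Moving the base point of an affine action by `w`. -/
theorem translate_mem_Z1 (ρ : BanachRep.{u, v} G) {b : G → ρ.E} (hb : b ∈ ρ.Z1) (w : ρ.E) :
    (fun g => b g + ρ.π g w - w) ∈ ρ.Z1 := by
  have h := ρ.Z1.sub_mem hb (ρ.coboundary_mem_Z1 w)
  convert h using 1
  ext g
  simp only [Pi.sub_apply]
  abel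

theorem subsingleton_H1_iff (ρ : BanachRep.{u, v} G) :
    Subsingleton ρ.H1 ↔ ∀ b ∈ ρ.Z1, ∃ x : ρ.E, ∀ g, b g = x - ρ.π g x := by
  rw [Submodule.Quotient.subsingleton_iff, Submodule.eq_top_iff']
  exact ⟨fun h b hb => h ⟨b, hb⟩, fun h b => h b.1 b.2⟩

variable [IsTopologicalGroup G] [T2Space G] [LocallyCompactSpace G] {S : Set G}

/-- The bounds on `S` propagate uniformly to compact sets. -/
theorem exists_uniform_bound (hS : IsCompact S) (hS_symm : S⁻¹ = S)
    (hS_one : (1 : G) ∈ S) (hS_gen : Subgroup.closure S = ⊤) {M : ℝ} (hM : 1 ≤ M)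
    {K : Set G} (hK : IsCompact K) :
    ∃ C : ℝ, 0 ≤ C ∧ ∀ ρ : BanachRep.{u, v} G, (∀ g ∈ S, ‖ρ.π g‖ ≤ M) →
      (∀ g ∈ K, ‖ρ.π g‖ ≤ C) ∧
      ∀ b ∈ ρ.Z1, ∀ D : ℝ, (∀ s ∈ S, ‖b s‖ ≤ D) → ∀ g ∈ K, ‖b g‖ ≤ C * D := by
  obtain ⟨n, hn⟩ := exists_subset_pow_of_isCompact hS hS_symm hS_one hS_gen hK
  have hMn : 0 ≤ M ^ n := by positivity
  have hn0 : (0 : ℝ) ≤ n := n.cast_nonneg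
  refine ⟨(n + 1) * M ^ n, by positivity, fun ρ hρ => ⟨fun g hg => ?_, fun b hb D hD g hg => ?_⟩⟩
  · exact (ρ.norm_le_pow_of_mem_pow hM hρ n g (hn hg)).trans (by nlinarith)
  · have hD0 : 0 ≤ D := (norm_nonneg _).trans (hD 1 hS_one)
    refine (ρ.norm_cocycle_le_of_mem_pow hM hρ hb hD0 hD n g (hn hg)).trans ?_
    gcongr
    linarith

theorem bddOnCompacts_of_forall_le (hS : IsCompact S) (hS_symm : S⁻¹ = S)
    (hS_one : (1 : G) ∈ S) (hS_gen : Subgroup.closure S = ⊤) {M : ℝ} (hM : 1 ≤ M)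
    {F : Set (BanachRep.{u, v} G)} (hF : ∀ ρ ∈ F, ∀ g ∈ S, ‖ρ.π g‖ ≤ M) : BddOnCompacts F := by
  intro K hK
  obtain ⟨C, -, hC⟩ := exists_uniform_bound.{u, v} hS hS_symm hS_one hS_gen hM hK
  exact ⟨C, fun ρ hρ => (hC ρ (hF ρ hρ)).1⟩

variable [MeasurableSpace G] [BorelSpace G] (μ : Measure G) [μ.IsHaarMeasure]

/-- The distance by which `σ(m)` moves the origin is controlled by the displacement there. The point
is that `C` depends on `m` but neither on the representation nor on the cocycle. -/
theorem exists_bound_integral_cocycle (hS : IsCompact S) (hS_symm : S⁻¹ = S)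
    (hS_one : (1 : G) ∈ S) (hS_gen : Subgroup.closure S = ⊤) {M : ℝ} (hM : 1 ≤ M)
    (m : C_c(G, ℂ)) :
    ∃ C : ℝ, 0 ≤ C ∧ ∀ ρ : BanachRep.{u, v} G, (∀ g ∈ S, ‖ρ.π g‖ ≤ M) →
      ∀ b ∈ ρ.Z1, ∀ D : ℝ, (∀ s ∈ S, ‖b s‖ ≤ D) → ‖∫ g, m g • b g ∂μ‖ ≤ C * D := by
  obtain ⟨C, hC0, hC⟩ := exists_uniform_bound.{u, v} hS hS_symm hS_one hS_gen hM
    m.hasCompactSupport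
  refine ⟨(∫ g, ‖m g‖ ∂μ) * C, mul_nonneg (integral_nonneg fun _ => norm_nonneg _) hC0,
    fun ρ hρ b hb D hD => ?_⟩
  rw [mul_assoc]
  exact norm_integral_smul_le μ m ((hC ρ hρ).2 b hb D hD)

end Bounds

end BanachRep

/-! ### Contraction of displacements and fixed points -/

namespace BanachRep

section Contraction

set_option linter.unusedSectionVars false

variable {G : Type u} [Group G] [TopologicalSpace G] [IsTopologicalGroup G]
  [MeasurableSpace G] [BorelSpace G] (μ : Measure G) [μ.IsHaarMeasure]

/-- For every affine action `σ` with linear part `ρ`, the operator `σ(m)` contracts the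
displacement `sup {‖σ(s) x - x‖ : s ∈ S}` by the factor `κ`. By translation it is enough to express
this at the origin, where the displacement is `sup {‖b s‖ : s ∈ S}`. -/
def Contracts (S : Set G) (m : C_c(G, ℂ)) (κ : ℝ) (ρ : BanachRep.{u, v} G) : Prop :=
  ∀ b ∈ ρ.Z1, (∀ s ∈ S, ‖b s‖ ≤ 1) →
    ∀ s ∈ S, ‖b s + ρ.π s (∫ g, m g • b g ∂μ) - ∫ g, m g • b g ∂μ‖ ≤ κ

variable {μ} in
theorem Contracts.le_mul {S : Set G} {m : C_c(G, ℂ)} {κ : ℝ} {ρ : BanachRep.{u, v} G}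
    (h : Contracts μ S m κ ρ) {b : G → ρ.E} (hb : b ∈ ρ.Z1) {D : ℝ} (hD : ∀ s ∈ S, ‖b s‖ ≤ D)
    {s : G} (hs : s ∈ S) :
    ‖b s + ρ.π s (∫ g, m g • b g ∂μ) - ∫ g, m g • b g ∂μ‖ ≤ κ * D := by
  have hD0 : 0 ≤ D := (norm_nonneg _).trans (hD s hs)
  -- `D` may be zero, so `b` is rescaled by each `D' > D`, and `D'` then tends to `D`.
  have key : ∀ D' ∈ Set.Ioi D,
      ‖b s + ρ.π s (∫ g, m g • b g ∂μ) - ∫ g, m g • b g ∂μ‖ ≤ κ * D' := by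
    intro D' hD'
    have hpos : 0 < D' := hD0.trans_lt hD'
    have hnorm : ‖((D' : ℂ)⁻¹)‖ = D'⁻¹ := by
      rw [norm_inv, Complex.norm_real, Real.norm_of_nonneg hpos.le]
    have h1 := h ((D' : ℂ)⁻¹ • b) (ρ.Z1.smul_mem _ hb) (fun t ht => by
      rw [Pi.smul_apply, norm_smul, hnorm, inv_mul_le_iff₀ hpos, mul_one]
      exact (hD t ht).trans (le_of_lt hD')) s hs
    have h2 : ∫ g, m g • ((D' : ℂ)⁻¹ • b) g ∂μ = (D' : ℂ)⁻¹ • ∫ g, m g • b g ∂μ := by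
      rw [← integral_smul]
      exact integral_congr_ae (Filter.Eventually.of_forall fun g => smul_comm _ _ _)
    rw [h2, Pi.smul_apply, map_smul, ← smul_add, ← smul_sub, norm_smul, hnorm,
      inv_mul_le_iff₀ hpos, mul_comm] at h1
    exact h1
  refine ge_of_tendsto (x := 𝓝[>] D) (f := fun D' => κ * D') ?_ ?_
  · exact ((continuous_const_mul κ).tendsto D).mono_left nhdsWithin_le_nhds
  · exact Filter.mem_of_superset self_mem_nhdsWithin key

theorem op_apply_of_mem_invariants (ρ : BanachRep.{u, v} G) {m : C_c(G, ℂ)}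
    (hm : ∫ g, m g ∂μ = 1) {x : ρ.E} (hx : x ∈ ρ.invariants) : ρ.op μ m x = x := by
  have h : ∀ g, m g • ρ.π g x = m g • x := fun g => by rw [hx g]
  rw [op_apply]
  simp only [h]
  rw [integral_smul_const, hm, one_smul]

/-- The affine action attached to `x - π(g) x` fixes `x`; the integral is the image of the origin
under its average. -/
theorem integral_smul_coboundary (ρ : BanachRep.{u, v} G) {m : C_c(G, ℂ)}
    (hm : ∫ g, m g ∂μ = 1) (x : ρ.E) :
    ∫ g, m g • (x - ρ.π g x) ∂μ = x - ρ.op μ m x := by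
  simp only [smul_sub]
  rw [integral_sub ((integrable_Cc μ m).smul_const x)
    (ρ.integrable_smul μ m x), integral_smul_const, hm, one_smul, op_apply]

theorem norm_ext_le {F : Set (BanachRep.{u, v} G)} {hF : BddOnCompacts F}
    {ρ : BanachRep.{u, v} G} (hρ : ρ ∈ F) : ‖ext (hF := hF) μ hρ‖ ≤ 1 := by
  refine ContinuousLinearMap.opNorm_le_bound _ zero_le_one fun q => ?_
  induction q using Completion.induction_on with
  | hp => exact isClosed_le (ext μ hρ).continuous.norm (continuous_const.mul continuous_norm)
  | ih f =>
    rw [one_mul, Completion.norm_coe]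
    exact (congrArg norm (ext_toCF (hF := hF) μ hρ f)).trans_le (norm_op_le_normF μ hF hρ f)

theorem IsKazhdanProjection.exists_norm_sub_le {F : Set (BanachRep.{u, v} G)}
    {hF : BddOnCompacts F} {p : CF μ F hF} (hp : IsKazhdanProjection μ p) {ε : ℝ} (hε : 0 < ε) :
    ∃ m : C_c(G, ℂ), ∫ g, m g ∂μ = 1 ∧
      ∀ (ρ : BanachRep.{u, v} G) (hρ : ρ ∈ F), ‖ρ.op μ m - ext μ hρ p‖ ≤ ε := by
  obtain ⟨_, ⟨m, hm, rfl⟩, hd⟩ := Metric.mem_closure_iff.1 hp.mem_closure ε hε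
  refine ⟨m, hm, fun ρ hρ => ?_⟩
  rw [← ext_toCF (hF := hF) μ hρ, ← map_sub]
  refine ((ext μ hρ).le_of_opNorm_le (norm_ext_le μ hρ) _).trans ?_
  rw [one_mul, ← dist_eq_norm, dist_comm]
  exact hd.le

variable [T2Space G] [LocallyCompactSpace G] {S : Set G}

/-- Vanishing of `H¹` supplies a fixed point `x`, and `x - y` with `y = π(p) x` is another one,
since `y` is invariant. It lies at distance at most `2 C` from the origin, and `σ(m) 0` is close to
it when `m` is close to `p`; a point close to a fixed point has small displacement. -/
theorem HasKazhdanProjection.exists_contracts (hS : IsCompact S) (hS_symm : S⁻¹ = S)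
    (hS_one : (1 : G) ∈ S) (hS_gen : Subgroup.closure S = ⊤) {M : ℝ} (hM : 1 ≤ M)
    {F : Set (BanachRep.{u, v} G)} (hFM : ∀ ρ ∈ F, ∀ g ∈ S, ‖ρ.π g‖ ≤ M)
    (hF : HasKazhdanProjection μ F) (hH1 : ∀ ρ ∈ F, Subsingleton ρ.H1) {κ : ℝ} (hκ : 0 < κ) :
    ∃ m : C_c(G, ℂ), ∫ g, m g ∂μ = 1 ∧ ∀ ρ ∈ F, Contracts μ S m κ ρ := by
  obtain ⟨hF, p, hp⟩ := hF
  -- The auxiliary `m₀` serves only to bound `‖x - y‖`: it gives `‖x - y‖ ≤ C + ‖x - y‖ / 2`. The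
  -- tolerance for `m` is then chosen in terms of `C`.
  obtain ⟨m₀, hm₀, hm₀p⟩ := hp.exists_norm_sub_le μ (ε := 1 / 2) (by norm_num)
  obtain ⟨C, hC0, hC⟩ := exists_bound_integral_cocycle.{u, v} μ hS hS_symm hS_one hS_gen hM m₀
  have hpos : 0 < (M + 1) * (2 * C + 1) := by positivity
  obtain ⟨m, hm, hmp⟩ := hp.exists_norm_sub_le μ (ε := κ / ((M + 1) * (2 * C + 1)))
    (div_pos hκ hpos)
  refine ⟨m, hm, fun ρ hρ b hb hb1 s hs => ?_⟩
  obtain ⟨x, hx⟩ := (subsingleton_H1_iff ρ).1 (hH1 ρ hρ) b hb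
  obtain rfl : b = fun g => x - ρ.π g x := funext hx
  set y := ext μ hρ p x with hy
  have hyinv : y ∈ ρ.invariants := (hp.isProj ρ hρ).map_mem x
  have happrox : ∀ (f : C_c(G, ℂ)) (ε : ℝ), ∫ g, f g ∂μ = 1 → ‖ρ.op μ f - ext μ hρ p‖ ≤ ε →
      ‖ρ.op μ f x - y‖ ≤ ε * ‖x - y‖ := by
    intro f ε hf hfε
    -- Both operators fix the invariant vector `y`, so the error is proportional to `‖x - y‖`
    -- instead of `‖x‖`, which is not controlled.
    have h1 : ρ.op μ f x - y = (ρ.op μ f - ext μ hρ p) (x - y) := by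
      have h2 : ext μ hρ p y = y := (hp.isProj ρ hρ).map_id y hyinv
      rw [_root_.sub_apply, map_sub, map_sub, op_apply_of_mem_invariants μ ρ hf hyinv, h2, ← hy]
      abel
    rw [h1]
    exact ContinuousLinearMap.le_of_opNorm_le _ hfε _
  have hdist : ‖x - y‖ ≤ 2 * C := by
    have h1 := hC ρ (hFM ρ hρ) _ hb 1 hb1
    rw [integral_smul_coboundary μ ρ hm₀, mul_one] at h1
    have h2 := happrox m₀ _ hm₀ (hm₀p ρ hρ)
    have h3 : ‖x - y‖ ≤ ‖x - ρ.op μ m₀ x‖ + ‖ρ.op μ m₀ x - y‖ := by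
      have := norm_add_le (x - ρ.op μ m₀ x) (ρ.op μ m₀ x - y)
      rwa [sub_add_sub_cancel] at this
    linarith
  set z := ρ.op μ m x - y with hz
  have hzle : ‖z‖ ≤ κ / ((M + 1) * (2 * C + 1)) * (2 * C + 1) := by
    refine (happrox m _ hm (hmp ρ hρ)).trans ?_
    gcongr
    linarith
  have heq : (x - ρ.π s x) + ρ.π s (x - ρ.op μ m x) - (x - ρ.op μ m x) = z - ρ.π s z := by
    rw [hz, map_sub, map_sub, hyinv s]
    abel
  simp only [integral_smul_coboundary μ ρ hm]
  rw [heq]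
  calc ‖z - ρ.π s z‖ ≤ ‖z‖ + M * ‖z‖ :=
        (norm_sub_le _ _).trans (by gcongr; exact (ρ.π s).le_of_opNorm_le (hFM ρ hρ s hs) z)
    _ = (M + 1) * ‖z‖ := by ring
    _ ≤ (M + 1) * (κ / ((M + 1) * (2 * C + 1)) * (2 * C + 1)) := by gcongr
    _ = κ := by field_simp

theorem forall_eq_of_forall_mem_generators (hS_gen : Subgroup.closure S = ⊤)
    (ρ : BanachRep.{u, v} G) {b : G → ρ.E} (hb : b ∈ ρ.Z1) {x : ρ.E}
    (h : ∀ s ∈ S, b s = x - ρ.π s x) (g : G) : b g = x - ρ.π g x := by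
  have hg : g ∈ Subgroup.closure S := by rw [hS_gen]; trivial
  induction hg using Subgroup.closure_induction with
  | mem s hs => exact h s hs
  | one => rw [ρ.cocycle_one hb, map_one]; simp
  | mul g k _ _ hg hk =>
    rw [hb.2, hg, hk, map_mul, map_sub, mul_apply_eq_comp]
    abel
  | inv g _ hg =>
    have h1 := hb.2 g⁻¹ g
    rw [inv_mul_cancel, ρ.cocycle_one hb, hg, map_sub] at h1
    have h2 : ρ.π g⁻¹ (ρ.π g x) = x := by
      rw [← mul_apply_eq_comp, ← map_mul, inv_mul_cancel, map_one]
      rfl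
    rw [h2] at h1
    rw [eq_neg_of_add_eq_zero_left h1.symm]
    abel

/-- Under iteration of `σ(m)` the displacement decays geometrically, and each step is at most a
constant times the current displacement. The iterates therefore converge, and the limit has
displacement zero. -/
theorem Contracts.subsingleton_H1 (hS : IsCompact S) (hS_symm : S⁻¹ = S)
    (hS_one : (1 : G) ∈ S) (hS_gen : Subgroup.closure S = ⊤) {M : ℝ} (hM : 1 ≤ M)
    {ρ : BanachRep.{u, v} G} (hρ : ∀ g ∈ S, ‖ρ.π g‖ ≤ M) {m : C_c(G, ℂ)} {κ : ℝ} (hκ : κ < 1)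
    (hκ0 : 0 ≤ κ) (h : Contracts μ S m κ ρ) : Subsingleton ρ.H1 := by
  refine (subsingleton_H1_iff ρ).2 fun b hb => ?_
  obtain ⟨C, hC0, hC⟩ := exists_bound_integral_cocycle.{u, v} μ hS hS_symm hS_one hS_gen hM m
  obtain ⟨D, hD⟩ := hS.exists_bound_of_continuousOn hb.1.continuousOn
  -- The orbit of the origin under `σ(m)`: the integrand is the cocycle of `σ` with base point moved
  -- to `w`.
  let w : ℕ → ρ.E := fun n =>
    Nat.rec 0 (fun _ w => w + ∫ g, m g • (b g + ρ.π g w - w) ∂μ) n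
  have hw : ∀ n, w (n + 1) = w n + ∫ g, m g • (b g + ρ.π g (w n) - w n) ∂μ := fun n => rfl
  have hdisp : ∀ n, ∀ s ∈ S, ‖b s + ρ.π s (w n) - w n‖ ≤ κ ^ n * D := by
    intro n
    induction n with
    | zero => simpa [w] using hD
    | succ n ih =>
      intro s hs
      have h1 := h.le_mul (ρ.translate_mem_Z1 hb (w n)) ih hs
      rw [pow_succ', mul_assoc]
      refine le_of_eq_of_le ?_ h1
      rw [hw, map_add]
      congr 1
      abel
  have hstep : ∀ n, dist (w n) (w (n + 1)) ≤ C * D * κ ^ n := by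
    intro n
    rw [dist_comm, dist_eq_norm, hw, add_sub_cancel_left, mul_assoc, mul_comm D]
    exact hC ρ hρ _ (ρ.translate_mem_Z1 hb (w n)) _ (hdisp n)
  obtain ⟨x, hx⟩ := cauchySeq_tendsto_of_complete (cauchySeq_of_le_geometric _ _ hκ hstep)
  refine ⟨x, ρ.forall_eq_of_forall_mem_generators hS_gen hb fun s hs => ?_⟩
  have h1 : Filter.Tendsto (fun n => b s + ρ.π s (w n) - w n) Filter.atTop
      (𝓝 (b s + ρ.π s x - x)) :=
    (tendsto_const_nhds.add (((ρ.π s).continuous.tendsto x).comp hx)).sub hx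
  have h2 : Filter.Tendsto (fun n => b s + ρ.π s (w n) - w n) Filter.atTop (𝓝 0) := by
    refine squeeze_zero_norm (fun n => hdisp n s hs) ?_
    simpa using (tendsto_pow_atTop_nhds_zero_of_lt_one hκ0 hκ).mul_const D
  have h3 := tendsto_nhds_unique h1 h2
  rw [eq_sub_iff_add_eq, ← sub_eq_zero]
  exact h3

end Contraction

end BanachRep

/-! ### Convolution powers converging to a Kazhdan projection -/

namespace BanachRep

section Construction

set_option linter.unusedSectionVars false

variable {G : Type u} [Group G] [TopologicalSpace G] [IsTopologicalGroup G]
  [MeasurableSpace G] [BorelSpace G] (μ : Measure G) [μ.IsHaarMeasure]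

theorem op_sub (ρ : BanachRep.{u, v} G) (f₁ f₂ : C_c(G, ℂ)) :
    ρ.op μ (f₁ - f₂) = ρ.op μ f₁ - ρ.op μ f₂ := by
  have h : f₁ - f₂ = f₁ + (-1 : ℂ) • f₂ := by
    ext g
    simp [sub_eq_add_neg]
  rw [h, op_add, op_smul, neg_one_smul, ← sub_eq_add_neg]

theorem integral_conv_smul {E : Type v} [NormedAddCommGroup E] [NormedSpace ℂ E]
    [CompleteSpace E] (f₁ f₂ : C_c(G, ℂ)) {φ : G → E} (hφ : Continuous φ) :
    ∫ g, conv μ f₁ f₂ g • φ g ∂μ = ∫ h, f₁ h • ∫ g, f₂ g • φ (h * g) ∂μ ∂μ := by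
  have hswap : ∫ h, (∫ g, (f₁ h * f₂ (h⁻¹ * g)) • φ g ∂μ) ∂μ
      = ∫ g, (∫ h, (f₁ h * f₂ (h⁻¹ * g)) • φ g ∂μ) ∂μ := by
    apply integral_integral_swap_of_hasCompactSupport
    · have h1 := f₁.continuous
      have h2 := f₂.continuous
      exact Continuous.smul (by fun_prop) (hφ.comp continuous_snd)
    · have hK : IsCompact (tsupport f₁ * tsupport f₂) :=
        f₁.hasCompactSupport.isCompact.mul f₂.hasCompactSupport.isCompact
      refine HasCompactSupport.intro' (f₁.hasCompactSupport.isCompact.prod hK.closure)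
        ((isClosed_tsupport _).prod isClosed_closure) ?_
      rintro ⟨h, g⟩ hg
      by_cases h1 : h ∈ tsupport f₁
      · by_cases h2 : h⁻¹ * g ∈ tsupport f₂
        · exact absurd ⟨h1, subset_closure ⟨h, h1, h⁻¹ * g, h2, by simp⟩⟩ hg
        · simp [image_eq_zero_of_notMem_tsupport h2]
      · simp [image_eq_zero_of_notMem_tsupport h1]
  have hL : ∀ h, f₁ h • ∫ g, f₂ g • φ (h * g) ∂μ = ∫ g, (f₁ h * f₂ (h⁻¹ * g)) • φ g ∂μ := by
    intro h
    rw [← integral_smul, ← integral_mul_left_eq_self (fun g => (f₁ h * f₂ (h⁻¹ * g)) • φ g) h]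
    refine integral_congr_ae (Filter.Eventually.of_forall fun g => ?_)
    simp [mul_smul]
  have hR : ∀ g, conv μ f₁ f₂ g • φ g = ∫ h, (f₁ h * f₂ (h⁻¹ * g)) • φ g ∂μ :=
    fun g => (integral_smul_const _ _).symm
  simp only [hL, hR]
  exact hswap.symm

theorem integral_conv (f₁ f₂ : C_c(G, ℂ)) :
    ∫ g, conv μ f₁ f₂ g ∂μ = (∫ g, f₁ g ∂μ) * ∫ g, f₂ g ∂μ := by
  have h := integral_conv_smul μ f₁ f₂ (φ := fun _ => (1 : ℂ)) continuous_const
  simp only [smul_eq_mul, mul_one] at h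
  rw [h, integral_mul_const]

theorem integral_smul_cocycle_mul (ρ : BanachRep.{u, v} G) {b : G → ρ.E} (hb : b ∈ ρ.Z1)
    {f : C_c(G, ℂ)} (hf : ∫ g, f g ∂μ = 1) (h : G) :
    ∫ g, f g • b (h * g) ∂μ = b h + ρ.π h (∫ g, f g • b g ∂μ) := by
  rw [← (ρ.π h).integral_comp_comm (integrable_smul_of_continuous μ f hb.1)]
  have h1 : ∀ g, f g • b (h * g) = f g • b h + ρ.π h (f g • b g) := fun g => by
    rw [hb.2, smul_add, map_smul]
  simp only [h1]
  rw [integral_add ((integrable_Cc μ f).smul_const _)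
    ((ρ.π h).integrable_comp (integrable_smul_of_continuous μ f hb.1)), integral_smul_const, hf,
    one_smul]

/-- `σ(f₁ * f₂) 0 = σ(f₁) (σ(f₂) 0)` for an affine action `σ`, with the right-hand side computed
after moving the base point to `w = σ(f₂) 0`. -/
theorem integral_conv_smul_cocycle (ρ : BanachRep.{u, v} G) {b : G → ρ.E} (hb : b ∈ ρ.Z1)
    {f₁ f₂ : C_c(G, ℂ)} (hf₁ : ∫ g, f₁ g ∂μ = 1) (hf₂ : ∫ g, f₂ g ∂μ = 1) {w : ρ.E}
    (hw : ∫ g, f₂ g • b g ∂μ = w) :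
    ∫ g, conv μ f₁ f₂ g • b g ∂μ = w + ∫ g, f₁ g • (b g + ρ.π g w - w) ∂μ := by
  rw [integral_conv_smul μ f₁ f₂ hb.1]
  simp only [integral_smul_cocycle_mul μ ρ hb hf₂, hw]
  have h1 : ∀ g, f₁ g • (b g + ρ.π g w - w) = f₁ g • (b g + ρ.π g w) - f₁ g • w :=
    fun g => smul_sub _ _ _
  simp only [h1]
  have h2 : Continuous fun g => b g + ρ.π g w := hb.1.add (ρ.continuous_apply w)
  rw [integral_sub (integrable_smul_of_continuous μ f₁ h2) ((integrable_Cc μ f₁).smul_const _),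
    integral_smul_const, hf₁, one_smul, add_sub_cancel]

/-- The convolution power `m * ⋯ * m` with `n + 1` factors. -/
noncomputable def convPow (m : C_c(G, ℂ)) : ℕ → C_c(G, ℂ)
  | 0 => m
  | n + 1 => conv μ m (convPow m n)

theorem op_convPow (ρ : BanachRep.{u, v} G) (m : C_c(G, ℂ)) (n : ℕ) :
    ρ.op μ (convPow μ m n) = ρ.op μ m ^ (n + 1) := by
  induction n with
  | zero => rw [pow_one]; rfl
  | succ n ih =>
    rw [convPow, op_conv, ih, pow_succ' _ (n + 1)]
    rfl

theorem integral_convPow {m : C_c(G, ℂ)} (hm : ∫ g, m g ∂μ = 1) (n : ℕ) :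
    ∫ g, convPow μ m n g ∂μ = 1 := by
  induction n with
  | zero => exact hm
  | succ n ih => rw [convPow, integral_conv, hm, ih, mul_one]

theorem dist_toCF {F : Set (BanachRep.{u, v} G)} {hF : BddOnCompacts F} (f₁ f₂ : C_c(G, ℂ)) :
    dist (toCF μ F hF f₁) (toCF μ F hF f₂) = normF μ F (f₁ - f₂) := by
  have h : dist (toCF μ F hF f₁) (toCF μ F hF f₂)
      = dist (show CcF F hF μ from f₁) (show CcF F hF μ from f₂) := Completion.dist_eq _ _
  rw [h, dist_eq_norm]
  rfl

theorem continuous_mul_self_CF {F : Set (BanachRep.{u, v} G)} {hF : BddOnCompacts F} :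
    Continuous fun q : CF μ F hF => q * q :=
  (continuous_mul_CF (hF := hF) μ).comp (continuous_id.prodMk continuous_id)

variable [T2Space G] [LocallyCompactSpace G] {S : Set G}

/-- Contraction is applied to the coboundaries of the vectors `π(m)ⁿ x`, that is, to the linear
action with moved base point. The decay is uniform over `F` and over the unit ball, so the
convolution powers are Cauchy in `C_F(G)`, and their limit maps every vector to a vector of
displacement zero. -/
theorem hasKazhdanProjection_of_contracts (hS : IsCompact S) (hS_symm : S⁻¹ = S)
    (hS_one : (1 : G) ∈ S) (hS_gen : Subgroup.closure S = ⊤) {M : ℝ} (hM : 1 ≤ M)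
    {F : Set (BanachRep.{u, v} G)} (hFM : ∀ ρ ∈ F, ∀ g ∈ S, ‖ρ.π g‖ ≤ M) {m : C_c(G, ℂ)}
    (hm : ∫ g, m g ∂μ = 1) {κ : ℝ} (hκ : κ < 1) (hκ0 : 0 ≤ κ)
    (h : ∀ ρ ∈ F, Contracts μ S m κ ρ) : HasKazhdanProjection μ F := by
  have hF : BddOnCompacts F := bddOnCompacts_of_forall_le hS hS_symm hS_one hS_gen hM hFM
  obtain ⟨C, hC0, hC⟩ := exists_bound_integral_cocycle.{u, v} μ hS hS_symm hS_one hS_gen hM m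
  have hdisp : ∀ ρ ∈ F, ∀ (x : ρ.E) (n : ℕ), ∀ s ∈ S,
      ‖(ρ.op μ m ^ n) x - ρ.π s ((ρ.op μ m ^ n) x)‖ ≤ κ ^ n * ((1 + M) * ‖x‖) := by
    intro ρ hρ x n
    induction n with
    | zero =>
      intro s hs
      rw [pow_zero, pow_zero, one_mul, add_mul, one_mul]
      exact (norm_sub_le _ _).trans
        (add_le_add le_rfl ((ρ.π s).le_of_opNorm_le (hFM ρ hρ s hs) x))
    | succ n ih =>
      intro s hs
      have h1 := (h ρ hρ).le_mul (ρ.coboundary_mem_Z1 ((ρ.op μ m ^ n) x)) ih hs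
      rw [integral_smul_coboundary μ ρ hm] at h1
      rw [pow_succ' κ, mul_assoc, pow_succ' (ρ.op μ m), mul_apply_eq_comp]
      refine le_of_eq_of_le ?_ h1
      rw [map_sub]
      congr 1
      abel
  have hstep : ∀ n, dist (toCF μ F hF (convPow μ m n)) (toCF μ F hF (convPow μ m (n + 1)))
      ≤ C * (1 + M) * κ * κ ^ n := by
    intro n
    rw [dist_toCF]
    refine normF_le μ (by positivity) fun ρ hρ => ?_
    rw [op_sub, op_convPow, op_convPow]
    refine ContinuousLinearMap.opNorm_le_bound _ (by positivity) fun x => ?_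
    have h1 := hC ρ (hFM ρ hρ) _ (ρ.coboundary_mem_Z1 ((ρ.op μ m ^ (n + 1)) x)) _
      (hdisp ρ hρ x (n + 1))
    rw [integral_smul_coboundary μ ρ hm] at h1
    rw [_root_.sub_apply, pow_succ' _ (n + 1), mul_apply_eq_comp]
    refine h1.trans (le_of_eq ?_)
    ring
  obtain ⟨p, hp⟩ := cauchySeq_tendsto_of_complete (cauchySeq_of_le_geometric _ _ hκ hstep)
  have hext : ∀ (ρ : BanachRep.{u, v} G) (hρ : ρ ∈ F) (x : ρ.E),
      Filter.Tendsto (fun n => (ρ.op μ m ^ (n + 1)) x) Filter.atTop (𝓝 (ext μ hρ p x)) := by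
    intro ρ hρ x
    have h1 := (((ext (hF := hF) μ hρ).continuous.tendsto p).comp hp)
    have h2 := ((ContinuousLinearMap.apply ℂ ρ.E x).continuous.tendsto _).comp h1
    refine h2.congr fun n => ?_
    simp only [Function.comp_apply, ext_toCF, op_convPow]
    rfl
  refine ⟨hF, p, ?_, ?_, fun ρ hρ => ⟨fun x => ?_, fun x hx => ?_⟩⟩
  · have h1 : Filter.Tendsto
        (fun n => toCF μ F hF (convPow μ m n) * toCF μ F hF (convPow μ m n)) Filter.atTop
        (𝓝 (p * p)) :=
      ((continuous_mul_self_CF μ).tendsto p).comp hp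
    -- `convPow μ m n` has `n + 1` factors, hence the index `2 * n + 1`. Equality is only needed in
    -- the completion, where it can be checked in each representation.
    have h2 : ∀ n, toCF μ F hF (convPow μ m n) * toCF μ F hF (convPow μ m n)
        = toCF μ F hF (convPow μ m (2 * n + 1)) := by
      intro n
      rw [toCF_mul, ← dist_le_zero, dist_toCF]
      refine normF_le μ le_rfl fun ρ hρ => le_of_eq ?_
      rw [op_sub, op_conv, op_convPow, op_convPow, norm_eq_zero, sub_eq_zero]
      change ρ.op μ m ^ (n + 1) * ρ.op μ m ^ (n + 1) = _
      rw [← pow_add]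
      congr 1
      ring
    simp only [h2] at h1
    have h3 : Filter.Tendsto (fun n : ℕ => 2 * n + 1) Filter.atTop Filter.atTop :=
      Filter.tendsto_atTop_mono (fun n => by simp only [id]; omega) Filter.tendsto_id
    exact tendsto_nhds_unique h1 (hp.comp h3)
  · exact mem_closure_of_tendsto hp
      (Filter.Eventually.of_forall fun n => ⟨_, integral_convPow μ hm n, rfl⟩)
  -- Invariance is expressed as triviality of the zero cocycle at `π(p) x`, which need only be
  -- tested on `S`.
  · have hgen : ∀ s ∈ S, (0 : G → ρ.E) s = ext μ hρ p x - ρ.π s (ext μ hρ p x) := by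
      intro s hs
      have h1 := (hext ρ hρ x).sub (((ρ.π s).continuous.tendsto _).comp (hext ρ hρ x))
      have h2 : Filter.Tendsto (fun n => κ ^ (n + 1) * ((1 + M) * ‖x‖)) Filter.atTop (𝓝 0) := by
        simpa using ((tendsto_pow_atTop_nhds_zero_of_lt_one hκ0 hκ).comp
          (Filter.tendsto_add_atTop_nat 1)).mul_const ((1 + M) * ‖x‖)
      exact tendsto_nhds_unique
        (squeeze_zero_norm (fun n => hdisp ρ hρ x (n + 1) s hs) h2) h1
    intro g
    have h1 := ρ.forall_eq_of_forall_mem_generators hS_gen ρ.Z1.zero_mem hgen g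
    exact (sub_eq_zero.1 h1.symm).symm
  · have h1 : ∀ n, (ρ.op μ m ^ (n + 1)) x = x := by
      intro n
      induction n with
      | zero => rw [zero_add, pow_one]; exact op_apply_of_mem_invariants μ ρ hm hx
      | succ n ih =>
        rw [pow_succ', mul_apply_eq_comp, ih]
        exact op_apply_of_mem_invariants μ ρ hm hx
    have h2 := hext ρ hρ x
    simp only [h1] at h2
    exact tendsto_nhds_unique h2 tendsto_const_nhds

end Construction

end BanachRep

-- Ultralimits of Banach spaces

universe w w'

section Ultralimit

open Filter

theorem Ultrafilter.exists_tendsto_of_bounded {X : Type w} (𝒰 : Ultrafilter X) {f : X → ℝ}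
    {B : ℝ} (hf : ∀ c, f c ∈ Set.Icc 0 B) : ∃ r, Tendsto f 𝒰 (𝓝 r) := by
  obtain ⟨r, -, hr⟩ := (isCompact_Icc (a := (0 : ℝ)) (b := B)).ultrafilter_le_nhds (𝒰.map f)
    (le_principal_iff.2 (Filter.mem_map.2 (Filter.univ_mem' hf)))
  exact ⟨r, hr⟩

/-- The completion of `V` for the seminorm `a ↦ lim ‖L c a‖` along an ultrafilter. -/
theorem exists_ultralimit_space {X : Type w} (𝒰 : Ultrafilter X) {E : X → Type w'}
    [∀ c, NormedAddCommGroup (E c)] [∀ c, NormedSpace ℂ (E c)] {V : Type u} [AddCommGroup V]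
    [Module ℂ V] (L : ∀ c, V →ₗ[ℂ] E c) (hL : ∀ a, ∃ B, ∀ c, ‖L c a‖ ≤ B) :
    ∃ (E' : Type u) (_ : NormedAddCommGroup E') (_ : NormedSpace ℂ E') (_ : CompleteSpace E')
      (ι : V →ₗ[ℂ] E'), DenseRange ι ∧ ∀ a, Tendsto (fun c => ‖L c a‖) 𝒰 (𝓝 ‖ι a‖) := by
  have hlim : ∀ a, ∃ r, Tendsto (fun c => ‖L c a‖) 𝒰 (𝓝 r) := fun a => by
    obtain ⟨B, hB⟩ := hL a
    exact 𝒰.exists_tendsto_of_bounded fun c => ⟨norm_nonneg _, hB c⟩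
  choose N hN using hlim
  let : Norm V := ⟨N⟩
  have core : SeminormedSpace.Core ℂ V :=
    { norm_nonneg := fun a => ge_of_tendsto' (hN a) fun c => norm_nonneg _
      norm_smul := fun t a => by
        refine tendsto_nhds_unique (hN (t • a)) (((hN a).const_mul ‖t‖).congr fun c => ?_)
        rw [map_smul, norm_smul]
      norm_triangle := fun a b =>
        le_of_tendsto_of_tendsto' (hN (a + b)) ((hN a).add (hN b)) fun c => by
          rw [map_add]
          exact norm_add_le _ _ }
  let : SeminormedAddCommGroup V := SeminormedAddCommGroup.ofCore core
  let : NormedSpace ℂ V := ⟨fun t a => (core.norm_smul t a).le⟩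
  refine ⟨Completion V, inferInstance, inferInstance, inferInstance,
    (Completion.toComplL (𝕜 := ℂ) (E := V)).toLinearMap, Completion.denseRange_coe, fun a => ?_⟩
  have h : ‖(Completion.toComplL (𝕜 := ℂ) (E := V)).toLinearMap a‖ = N a :=
    Completion.norm_coe a
  rw [h]
  exact hN a

/-- A point is determined by its distances to a dense sequence, so the space embeds in `ℕ → ℝ`. This
lets the ultralimit, built in the universe of `G`, be moved to the universe of the representation
spaces. -/
theorem small_of_separableSpace (E : Type w) [MetricSpace E] [TopologicalSpace.SeparableSpace E] :
    Small.{v} E := by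
  rcases isEmpty_or_nonempty E with h | h
  · exact small_of_injective (f := fun x : E => (h.elim x : PEmpty.{v + 1})) fun x => h.elim x
  · refine small_of_injective
      (f := fun x : E => fun n : ℕ => dist x (TopologicalSpace.denseSeq E n)) fun x y hxy => ?_
    have h1 : ∀ z, dist x z = dist y z := by
      intro z
      refine (TopologicalSpace.denseRange_denseSeq E).induction_on z
        (isClosed_eq (by fun_prop) (by fun_prop)) fun n => congrFun hxy n
    have h2 := h1 y
    rwa [dist_self, dist_eq_zero] at h2

theorem exists_linearIsometryEquiv_of_separableSpace (E : Type w) [NormedAddCommGroup E]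
    [NormedSpace ℂ E] [CompleteSpace E] [TopologicalSpace.SeparableSpace E] :
    ∃ (E' : Type v) (_ : NormedAddCommGroup E') (_ : NormedSpace ℂ E') (_ : CompleteSpace E'),
      Nonempty (E ≃ₗᵢ[ℂ] E') := by
  have : Small.{v} E := small_of_separableSpace E
  let e : Shrink.{v} E ≃ₗ[ℂ] E := Shrink.linearEquiv ℂ E
  let nG : NormedAddCommGroup (Shrink.{v} E) := NormedAddCommGroup.induced _ E e e.injective
  let nS : NormedSpace ℂ (Shrink.{v} E) := NormedSpace.induced ℂ (Shrink.{v} E) E e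
  let T : E ≃ₗᵢ[ℂ] Shrink.{v} E :=
    { e.symm with
      norm_map' := fun x => by
        change ‖e (e.symm x)‖ = ‖x‖
        rw [e.apply_symm_apply] }
  exact ⟨Shrink.{v} E, nG, nS,
    (T.symm.isometry.isUniformInducing.completeSpace_congr T.symm.surjective).2 inferInstance, ⟨T⟩⟩

/-- Operators on a dense subspace which define a locally bounded and strongly continuous
representation there extend to a representation on the whole space. -/
theorem exists_monoidHom_of_denseRange {G : Type w} [Group G] [TopologicalSpace G]
    [IsTopologicalGroup G] [LocallyCompactSpace G] {V : Type w'} [AddCommGroup V] [Module ℂ V]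
    {E : Type v} [NormedAddCommGroup E] [NormedSpace ℂ E] [CompleteSpace E]
    {ι : V →ₗ[ℂ] E} (hι : DenseRange ι) {A : G → V →ₗ[ℂ] V}
    (hone : ∀ a, ι (A 1 a) = ι a) (hmul : ∀ g h a, ι (A (g * h) a) = ι (A g (A h a)))
    (hbdd : ∀ K : Set G, IsCompact K → ∃ C, ∀ g ∈ K, ∀ a, ‖ι (A g a)‖ ≤ C * ‖ι a‖)
    (hcont : ∀ a, Tendsto (fun g => ι (A g a)) (𝓝 1) (𝓝 (ι a))) :
    ∃ π : G →* (E →L[ℂ] E), (∀ x, Continuous fun g => π g x) ∧ ∀ g a, π g (ι a) = ι (A g a) := by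
  have hg : ∀ g, ∃ C, ∀ a, ‖(ι ∘ₗ A g) a‖ ≤ C * ‖ι a‖ := fun g => by
    obtain ⟨C, hC⟩ := hbdd {g} isCompact_singleton
    exact ⟨C, hC g rfl⟩
  have hT : ∀ g a, (ι ∘ₗ A g).extendOfNorm ι (ι a) = ι (A g a) := fun g a =>
    LinearMap.extendOfNorm_eq hι (hg g) a
  let π : G →* (E →L[ℂ] E) :=
    { toFun := fun g => (ι ∘ₗ A g).extendOfNorm ι
      map_one' := by
        ext x
        refine hι.induction_on x (isClosed_eq (by fun_prop) (by fun_prop)) fun a => ?_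
        rw [hT, hone]
        rfl
      map_mul' := fun g h => by
        ext x
        refine hι.induction_on x (isClosed_eq (by fun_prop) (by fun_prop)) fun a => ?_
        rw [hT, hmul, mul_apply_eq_comp, hT, hT] }
  have hπ : ∀ g a, π g (ι a) = ι (A g a) := hT
  have hπle : ∀ K : Set G, IsCompact K → ∃ C, 0 ≤ C ∧ ∀ g ∈ K, ‖π g‖ ≤ C := by
    intro K hK
    obtain ⟨C, hC⟩ := hbdd K hK
    refine ⟨max C 0, le_max_right _ _, fun g hgK =>
      LinearMap.opNorm_extendOfNorm_le hι (le_max_right _ _) fun a => (hC g hgK a).trans ?_⟩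
    gcongr
    exact le_max_left _ _
  have h1 : ∀ x, Tendsto (fun g => π g x) (𝓝 1) (𝓝 x) := by
    intro x
    obtain ⟨K, hK, hK1⟩ := exists_compact_mem_nhds (1 : G)
    obtain ⟨C, hC0, hC⟩ := hπle K hK
    rw [Metric.tendsto_nhds]
    intro ε hε
    obtain ⟨a, ha⟩ := hι.exists_dist_lt x (ε := ε / (2 * (C + 1))) (by positivity)
    have ha' : (C + 1) * ‖x - ι a‖ < ε / 2 := by
      rw [dist_eq_norm, lt_div_iff₀ (by positivity)] at ha
      linarith
    filter_upwards [Metric.tendsto_nhds.1 (hcont a) (ε / 2) (half_pos hε), hK1] with g hg1 hgK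
    rw [dist_eq_norm, ← hπ] at hg1
    rw [dist_eq_norm]
    have heq : π g x - x = π g (x - ι a) + (π g (ι a) - ι a) - (x - ι a) := by
      rw [map_sub]; abel
    have h2 := (π g).le_of_opNorm_le (hC g hgK) (x - ι a)
    calc ‖π g x - x‖ ≤ ‖π g (x - ι a)‖ + ‖π g (ι a) - ι a‖ + ‖x - ι a‖ := by
          rw [heq]; exact (norm_sub_le _ _).trans (add_le_add (norm_add_le _ _) le_rfl)
      _ < ε := by linarith
  refine ⟨π, fun x => continuous_iff_continuousAt.2 fun g => ?_, hπ⟩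
  have h2 : Tendsto (fun k => π g (π (g⁻¹ * k) x)) (𝓝 g) (𝓝 (π g x)) := by
    refine ((π g).continuous.tendsto x).comp ((h1 x).comp ?_)
    have := (continuous_const_mul g⁻¹).tendsto g
    rwa [inv_mul_cancel] at this
  refine h2.congr fun k => ?_
  rw [← mul_apply_eq_comp, ← map_mul, mul_inv_cancel_left]

end Ultralimit

/-! ### Ultralimits of affine actions -/

namespace BanachRep

section UltralimitRep

open Filter

variable {G : Type u} [Group G]

/-- The operator `[h] ↦ [g h] - [g]` on finitely supported functions; it intertwines with `π(g)`
through the map `[h] ↦ b h` of a cocycle `b`. -/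
noncomputable def cocycleShift (g : G) : (G →₀ ℂ) →ₗ[ℂ] (G →₀ ℂ) :=
  Finsupp.linearCombination ℂ fun h => Finsupp.single (g * h) 1 - Finsupp.single g 1

variable [TopologicalSpace G]

theorem linearCombination_cocycleShift (ρ : BanachRep.{u, v} G) {b : G → ρ.E} (hb : b ∈ ρ.Z1)
    (g : G) (a : G →₀ ℂ) :
    Finsupp.linearCombination ℂ b (cocycleShift g a)
      = ρ.π g (Finsupp.linearCombination ℂ b a) := by
  have h : Finsupp.linearCombination ℂ b ∘ₗ cocycleShift g
      = (ρ.π g).toLinearMap ∘ₗ Finsupp.linearCombination ℂ b := by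
    ext h
    simp [cocycleShift, hb.2]
  exact LinearMap.congr_fun h a

variable {X : Type*} {ρ : X → BanachRep.{u, v} G} {b : ∀ c, G → (ρ c).E}

/-- Equicontinuity of the cocycles at `1` yields equicontinuity of the linear orbits of their
values, through `π(g) b(h) - b(h) = π(h) b(h⁻¹ g h) - b(g)`. This is what makes the ultralimit
strongly continuous. -/
theorem eventually_norm_linearCombination_sub_le [IsTopologicalGroup G]
    (hρ : BddOnCompacts (Set.range ρ))
    (hb : ∀ c, b c ∈ (ρ c).Z1) (hequi : ∀ ε > 0, ∀ᶠ g in 𝓝 (1 : G), ∀ c, ‖b c g‖ ≤ ε)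
    (a : G →₀ ℂ) : ∀ ε > 0, ∀ᶠ g in 𝓝 (1 : G), ∀ c,
      ‖(ρ c).π g (Finsupp.linearCombination ℂ (b c) a)
        - Finsupp.linearCombination ℂ (b c) a‖ ≤ ε := by
  induction a using Finsupp.induction_linear with
  | zero =>
    intro ε hε
    refine Eventually.of_forall fun g c => ?_
    simpa using hε.le
  | add a₁ a₂ h₁ h₂ =>
    intro ε hε
    filter_upwards [h₁ (ε / 2) (half_pos hε), h₂ (ε / 2) (half_pos hε)] with g hg₁ hg₂ c
    rw [map_add, map_add, add_sub_add_comm]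
    exact (norm_add_le _ _).trans ((add_le_add (hg₁ c) (hg₂ c)).trans (add_halves ε).le)
  | single h t =>
    intro ε hε
    obtain ⟨C, hC⟩ := hρ {h} isCompact_singleton
    have hconj : Tendsto (fun g => h⁻¹ * g * h) (𝓝 1) (𝓝 1) := by
      have : Continuous fun g => h⁻¹ * g * h := by fun_prop
      simpa using this.tendsto 1
    set η := ε / ((‖t‖ + 1) * (|C| + 1)) with hη
    have hη0 : 0 < η := by positivity
    filter_upwards [hequi η hη0, hconj.eventually (hequi η hη0)] with g hg₁ hg₂ c
    have heq : (ρ c).π g (b c h) - b c h = (ρ c).π h (b c (h⁻¹ * g * h)) - b c g := by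
      have h1 := (hb c).2 g h
      have h2 := (hb c).2 h (h⁻¹ * g * h)
      rw [← mul_assoc, ← mul_assoc, mul_inv_cancel, one_mul, h1] at h2
      rw [sub_eq_sub_iff_add_eq_add, add_comm, h2, add_comm]
    rw [Finsupp.linearCombination_single, map_smul, ← smul_sub, heq, norm_smul]
    have h3 : ‖(ρ c).π h (b c (h⁻¹ * g * h))‖ ≤ |C| * η :=
      ((ρ c).π h).le_of_opNorm_le_of_le ((hC _ ⟨c, rfl⟩ h rfl).trans (le_abs_self C)) (hg₂ c)
    calc ‖t‖ * ‖(ρ c).π h (b c (h⁻¹ * g * h)) - b c g‖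
        ≤ (‖t‖ + 1) * (|C| * η + η) := by
          gcongr
          · linarith
          · exact (norm_sub_le _ _).trans (add_le_add h3 (hg₁ c))
      _ = ε := by rw [hη]; field_simp

theorem exists_bound_linearCombination (hbdd : ∀ g, ∃ B, ∀ c, ‖b c g‖ ≤ B) (a : G →₀ ℂ) :
    ∃ B, ∀ c, ‖Finsupp.linearCombination ℂ (b c) a‖ ≤ B := by
  choose B hB using hbdd
  refine ⟨∑ g ∈ a.support, ‖a g‖ * B g, fun c => ?_⟩
  rw [Finsupp.linearCombination_apply, Finsupp.sum]
  refine (norm_sum_le _ _).trans (Finset.sum_le_sum fun g _ => ?_)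
  rw [norm_smul]
  exact mul_le_mul_of_nonneg_left (hB g c) (norm_nonneg _)

/-- The limit, along an ultrafilter, of a family of representations with an equicontinuous family
of cocycles: a representation on a separable space generated by the values of the limit cocycle. -/
theorem exists_ultralimit_rep [IsTopologicalGroup G] [LocallyCompactSpace G]
    [TopologicalSpace.SeparableSpace G] (𝒰 : Ultrafilter X) (hρ : BddOnCompacts (Set.range ρ))
    (hb : ∀ c, b c ∈ (ρ c).Z1) (hbdd : ∀ g, ∃ B, ∀ c, ‖b c g‖ ≤ B)
    (hequi : ∀ ε > 0, ∀ᶠ g in 𝓝 (1 : G), ∀ c, ‖b c g‖ ≤ ε) :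
    ∃ (ρ' : BanachRep.{u, v} G) (ι : (G →₀ ℂ) →ₗ[ℂ] ρ'.E),
      TopologicalSpace.SeparableSpace ρ'.E ∧ DenseRange ι ∧
      (∀ g a, ρ'.π g (ι a) = ι (cocycleShift g a)) ∧
      ∀ a, Tendsto (fun c => ‖Finsupp.linearCombination ℂ (b c) a‖) 𝒰 (𝓝 ‖ι a‖) := by
  obtain ⟨E₁, _, _, _, ι₁, hι₁, hlim⟩ :=
    exists_ultralimit_space 𝒰 (fun c => Finsupp.linearCombination ℂ (b c))
      (exists_bound_linearCombination hbdd)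
  have hle : ∀ (a : G →₀ ℂ) (r : ℝ), (∀ c, ‖Finsupp.linearCombination ℂ (b c) a‖ ≤ r) →
      ‖ι₁ a‖ ≤ r := fun a r h => le_of_tendsto' (hlim a) h
  -- Linear identities valid in every member of the family hold in the limit; the homomorphism
  -- property is obtained this way.
  have heq : ∀ a a' : G →₀ ℂ, (∀ c, Finsupp.linearCombination ℂ (b c) a
      = Finsupp.linearCombination ℂ (b c) a') → ι₁ a = ι₁ a' := by
    intro a a' h
    rw [← sub_eq_zero, ← map_sub, ← norm_le_zero_iff]
    exact hle _ _ fun c => by rw [map_sub, h c, sub_self, norm_zero]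
  have hsep : TopologicalSpace.SeparableSpace E₁ := by
    -- The limit cocycle is continuous on the separable group `G` and its values span a dense
    -- subspace, whence separability.
    have hβ : Continuous fun g => ι₁ (Finsupp.single g 1) := by
      refine continuous_iff_continuousAt.2 fun g => Metric.tendsto_nhds.2 fun ε hε => ?_
      obtain ⟨C, hC⟩ := hρ {g} isCompact_singleton
      have h1 : Tendsto (fun k => g⁻¹ * k) (𝓝 g) (𝓝 1) := by
        simpa using (continuous_const_mul g⁻¹).tendsto g
      have hη : 0 < ε / (2 * (|C| + 1)) := by positivity
      filter_upwards [h1.eventually (hequi _ hη)] with k hk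
      rw [dist_eq_norm, ← map_sub]
      refine (hle _ ((|C| + 1) * (ε / (2 * (|C| + 1)))) fun c => ?_).trans_lt ?_
      · have h2 := (hb c).2 g (g⁻¹ * k)
        rw [mul_inv_cancel_left] at h2
        simp only [map_sub, Finsupp.linearCombination_single, one_smul]
        rw [h2, add_sub_cancel_left]
        refine ((ρ c).π g).le_of_opNorm_le_of_le ?_ (hk c)
        have := (hC _ ⟨c, rfl⟩ g rfl).trans (le_abs_self C)
        linarith
      · have : (|C| + 1) * (ε / (2 * (|C| + 1))) = ε / 2 := by field_simp
        rw [this]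
        exact half_lt_self hε
    have h1 : (Submodule.span ℂ (Set.range fun g => ι₁ (Finsupp.single g 1)) : Set E₁)
        = Set.range ι₁ := by
      have h2 : Finsupp.linearCombination ℂ (fun g => ι₁ (Finsupp.single g 1)) = ι₁ := by
        ext g
        simp
      rw [← Finsupp.range_linearCombination, h2]
      rfl
    have h3 := (TopologicalSpace.isSeparable_range hβ).span (R := ℂ) |>.closure
    rw [h1, hι₁.closure_range] at h3
    exact TopologicalSpace.isSeparable_univ_iff.1 h3
  obtain ⟨E', _, _, _, ⟨T⟩⟩ := exists_linearIsometryEquiv_of_separableSpace.{v} E₁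
  let ι : (G →₀ ℂ) →ₗ[ℂ] E' := T.toLinearEquiv.toLinearMap ∘ₗ ι₁
  have hι : ∀ a, ι a = T (ι₁ a) := fun a => rfl
  have hιnorm : ∀ a, ‖ι a‖ = ‖ι₁ a‖ := fun a => T.norm_map _
  have hdense : DenseRange ι := T.surjective.denseRange.comp hι₁ T.continuous
  have hshift := fun c => linearCombination_cocycleShift (ρ c) (hb c)
  obtain ⟨π, hπ, hπι⟩ := exists_monoidHom_of_denseRange (G := G) hdense (A := cocycleShift)
    (fun a => by
      rw [hι, hι, heq _ a fun c => ?_]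
      rw [hshift, map_one]
      rfl)
    (fun g h a => by
      rw [hι, hι, heq _ (cocycleShift g (cocycleShift h a)) fun c => ?_]
      rw [hshift, hshift, hshift, map_mul, mul_apply_eq_comp])
    (fun K hK => by
      obtain ⟨C, hC⟩ := hρ K hK
      refine ⟨C, fun g hg a => ?_⟩
      rw [hιnorm, hιnorm]
      refine le_of_tendsto_of_tendsto' (hlim _) ((hlim a).const_mul C) fun c => ?_
      rw [hshift]
      exact ((ρ c).π g).le_of_opNorm_le (hC _ ⟨c, rfl⟩ g hg) _)
    (fun a => Metric.tendsto_nhds.2 fun ε hε => by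
      filter_upwards [eventually_norm_linearCombination_sub_le hρ hb hequi a (ε / 2)
        (half_pos hε)] with g hg
      rw [dist_eq_norm, ← map_sub, hιnorm]
      refine (hle _ (ε / 2) fun c => ?_).trans_lt (half_lt_self hε)
      rw [map_sub, hshift]
      exact hg c)
  refine ⟨⟨E', π, hπ⟩, ι, T.toHomeomorph.surjective.denseRange.separableSpace T.continuous,
    hdense, hπι, fun a => ?_⟩
  have := hlim a
  rwa [← hιnorm] at this

end UltralimitRep

end BanachRep

/-! ### Finite approximation of integrals and norms -/

section Approximation

open Filter

/-- A partition of unity subordinate to finitely many translates of `U` discretises the integral.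
The nodes depend only on `Q` and `U`, and the coefficients only on these and `f`, so one finite
combination serves simultaneously for all members of a family and for their limit. -/
theorem exists_integral_approx {G : Type u} [Group G] [TopologicalSpace G] [IsTopologicalGroup G]
    [T2Space G] [LocallyCompactSpace G] [MeasurableSpace G] [BorelSpace G] (μ : Measure G)
    [IsFiniteMeasureOnCompacts μ] {Q : Set G} (hQ : IsCompact Q) {U : Set G}
    (hU : U ∈ 𝓝 (1 : G)) :
    ∃ (N : ℕ) (t : Fin N → G), (∀ j, t j ∈ Q) ∧ ∀ f : C_c(G, ℂ), tsupport f ⊆ Q →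
      ∃ a : Fin N → ℂ, (∀ j, ‖a j‖ ≤ ∫ g, ‖f g‖ ∂μ) ∧
        ∀ (E : Type v) [NormedAddCommGroup E] [NormedSpace ℂ E] [CompleteSpace E] (φ : G → E),
          Continuous φ → ∀ η : ℝ, (∀ j, ∀ k ∈ U, ‖φ (t j * k) - φ (t j)‖ ≤ η) →
            ‖∫ g, f g • φ g ∂μ - ∑ j, a j • φ (t j)‖ ≤ (∫ g, ‖f g‖ ∂μ) * η := by
  obtain ⟨U', hU'U, hU'o, hU'1⟩ := mem_nhds_iff.1 hU
  have ho : ∀ g : G, IsOpen ((fun k => g⁻¹ * k) ⁻¹' U') := fun g =>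
    hU'o.preimage (continuous_const_mul g⁻¹)
  obtain ⟨T, hTQ, hT⟩ := hQ.elim_nhds_subcover (fun g => (fun k => g⁻¹ * k) ⁻¹' U') fun g _ =>
    (ho g).mem_nhds (by simpa using hU'1)
  let t : Fin T.card → G := fun j => T.equivFin.symm j
  have hcov : Q ⊆ ⋃ j, (fun k => (t j)⁻¹ * k) ⁻¹' U' := by
    intro g hg
    obtain ⟨i, hi, hgi⟩ := Set.mem_iUnion₂.1 (hT hg)
    refine Set.mem_iUnion.2 ⟨T.equivFin ⟨i, hi⟩, ?_⟩
    simpa [t] using hgi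
  obtain ⟨ψ, hψsupp, hψsum, hψ01, -⟩ :=
    exists_continuous_sum_one_of_isOpen_isCompact (fun j => ho (t j)) hQ hcov
  refine ⟨T.card, t, fun j => hTQ _ (T.equivFin.symm j).2, fun f hfQ => ?_⟩
  have hint : ∀ j, Integrable (fun g => f g * (ψ j g : ℂ)) μ := fun j =>
    Continuous.integrable_of_hasCompactSupport
      (f.continuous.mul (Complex.continuous_ofReal.comp (ψ j).continuous))
      f.hasCompactSupport.mul_right
  have hfint := BanachRep.integrable_Cc μ f
  have hψnorm : ∀ j g, ‖(ψ j g : ℂ)‖ = ψ j g := fun j g => by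
    rw [Complex.norm_real, Real.norm_of_nonneg (hψ01 j g).1]
  refine ⟨fun j => ∫ g, f g * (ψ j g : ℂ) ∂μ, fun j => ?_, fun E _ _ _ φ hφ η hη => ?_⟩
  · refine norm_integral_le_of_norm_le hfint.norm (Eventually.of_forall fun g => ?_)
    rw [norm_mul, hψnorm]
    exact mul_le_of_le_one_right (norm_nonneg _) (hψ01 j g).2
  · simp only [← integral_smul_const]
    rw [← integral_finsetSum _ fun j _ => (hint j).smul_const _,
      ← integral_sub (BanachRep.integrable_smul_of_continuous μ f hφ)
        (integrable_finsetSum _ fun j _ => (hint j).smul_const _), ← integral_mul_const]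
    refine norm_integral_le_of_norm_le (hfint.norm.mul_const _) (Eventually.of_forall fun g => ?_)
    by_cases hg : g ∈ tsupport f
    · have h1 : ∑ j, ψ j g = 1 := by simpa using hψsum (hfQ hg)
      have h2 : f g • φ g - ∑ j, (f g * (ψ j g : ℂ)) • φ (t j)
          = ∑ j, (f g * (ψ j g : ℂ)) • (φ g - φ (t j)) := by
        simp only [smul_sub, Finset.sum_sub_distrib]
        rw [← Finset.sum_smul, ← Finset.mul_sum, ← Complex.ofReal_sum, h1, Complex.ofReal_one,
          mul_one]
      have h3 : ∀ j, ‖(f g * (ψ j g : ℂ)) • (φ g - φ (t j))‖ ≤ ‖f g‖ * η * ψ j g := by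
        intro j
        by_cases hj : g ∈ tsupport (ψ j)
        · have h4 := hη j ((t j)⁻¹ * g) (hU'U (hψsupp j hj))
          rw [mul_inv_cancel_left] at h4
          rw [norm_smul, norm_mul, hψnorm, mul_right_comm (‖f g‖) η]
          exact mul_le_mul_of_nonneg_left h4 (mul_nonneg (norm_nonneg _) (hψ01 j g).1)
        · simp [image_eq_zero_of_notMem_tsupport hj]
      rw [h2]
      refine (norm_sum_le _ _).trans ((Finset.sum_le_sum fun j _ => h3 j).trans ?_)
      rw [← Finset.mul_sum, h1, mul_one]
    · simp [image_eq_zero_of_notMem_tsupport hg]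

theorem LinearMap.abs_norm_sum_smul_sub_le {V W I : Type*} [AddCommGroup V] [Module ℂ V]
    [NormedAddCommGroup W] [NormedSpace ℂ W] [Fintype I] (Λ : V →ₗ[ℂ] W) {y : I → V} {β : I → ℝ}
    (hβ : ∀ i, ‖Λ (y i)‖ ≤ β i) {r : ℝ} (hr : 0 ≤ r) {a a' : I → ℂ}
    (ha : ∀ i, ‖a i - a' i‖ ≤ r) :
    |‖Λ (∑ i, a i • y i)‖ - ‖Λ (∑ i, a' i • y i)‖| ≤ r * ∑ i, β i := by
  have hsub : ∑ i, a i • y i - ∑ i, a' i • y i = ∑ i, (a i - a' i) • y i := by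
    simp only [sub_smul, Finset.sum_sub_distrib]
  refine (abs_norm_sub_norm_le _ _).trans ?_
  rw [← map_sub, hsub, map_sum, Finset.mul_sum]
  refine (norm_sum_le _ _).trans (Finset.sum_le_sum fun i _ => ?_)
  rw [map_smul, norm_smul]
  exact mul_le_mul (ha i) (hβ i) (norm_nonneg _) hr

/-- Pointwise convergence of norms is uniform on bounded subsets of
finite-dimensional spaces. -/
theorem eventually_abs_norm_sub_norm_le {X : Type*} {l : Filter X} {E : X → Type*}
    [∀ c, NormedAddCommGroup (E c)] [∀ c, NormedSpace ℂ (E c)] {V : Type*} [AddCommGroup V]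
    [Module ℂ V] {E' : Type*} [NormedAddCommGroup E'] [NormedSpace ℂ E'] (L : ∀ c, V →ₗ[ℂ] E c)
    (hL : ∀ a, ∃ B, ∀ c, ‖L c a‖ ≤ B) (ι : V →ₗ[ℂ] E')
    (hlim : ∀ a, Tendsto (fun c => ‖L c a‖) l (𝓝 ‖ι a‖)) {I : Type*} [Fintype I] (y : I → V)
    {η : ℝ} (hη : 0 < η) :
    ∀ᶠ c in l, ∀ a : I → ℂ, (∀ i, ‖a i‖ ≤ 1) →
      |‖L c (∑ i, a i • y i)‖ - ‖ι (∑ i, a i • y i)‖| ≤ η := by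
  choose B hB using fun i => hL (y i)
  set R : ℝ := ∑ i, (|B i| + ‖ι (y i)‖) with hR
  have hR0 : 0 ≤ R := Finset.sum_nonneg fun i _ => by positivity
  have hη3 : 0 < η / (2 * (R + 1)) := by positivity
  -- A finite net of coefficient vectors reduces uniformity to finitely many pointwise limits; both
  -- norms are Lipschitz in the coefficients, with constants adding up to at most `R`.
  obtain ⟨T, -, hTfin, hT⟩ := (isCompact_closedBall (0 : I → ℂ) 1).finite_cover_balls hη3
  have hev : ∀ᶠ c in l, ∀ a ∈ T,
      |‖L c (∑ i, a i • y i)‖ - ‖ι (∑ i, a i • y i)‖| ≤ η / 2 := by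
    refine (eventually_all_finite hTfin).2 fun a _ => ?_
    have h := Metric.tendsto_nhds.1 (hlim (∑ i, a i • y i)) (η / 2) (half_pos hη)
    filter_upwards [h] with c hc
    exact hc.le
  filter_upwards [hev] with c hc a ha
  have ha' : a ∈ Metric.closedBall (0 : I → ℂ) 1 := by
    rw [mem_closedBall_zero_iff]
    exact (pi_norm_le_iff_of_nonneg zero_le_one).2 ha
  obtain ⟨a', ha'T, haa'⟩ := Set.mem_iUnion₂.1 (hT ha')
  have hdist : ∀ i, ‖a i - a' i‖ ≤ η / (2 * (R + 1)) := fun i => by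
    rw [← dist_eq_norm]
    exact (dist_le_pi_dist a a' i).trans (Metric.mem_ball.1 haa').le
  have h1 := (L c).abs_norm_sum_smul_sub_le (β := fun i => |B i|)
    (fun i => (hB i c).trans (le_abs_self _)) hη3.le hdist
  have h2 := ι.abs_norm_sum_smul_sub_le (fun i => le_refl ‖ι (y i)‖) hη3.le hdist
  have h3 := hc a' ha'T
  have h4 : η / (2 * (R + 1)) * ∑ i, |B i| + η / (2 * (R + 1)) * ∑ i, ‖ι (y i)‖ ≤ η / 2 := by
    rw [← mul_add, ← Finset.sum_add_distrib, ← hR]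
    calc η / (2 * (R + 1)) * R ≤ η / (2 * (R + 1)) * (R + 1) := by gcongr; linarith
      _ = η / 2 := by field_simp
  rw [abs_le] at *
  constructor <;> linarith [h1.1, h1.2, h2.1, h2.2, h3.1, h3.2]

end Approximation

/-! ### Convergence to the ultralimit in the Fell-like topology -/

namespace BanachRep

section Convergence

open Filter

variable {G : Type u} [Group G] [TopologicalSpace G] [IsTopologicalGroup G]
  [T2Space G] [LocallyCompactSpace G] [MeasurableSpace G] [BorelSpace G] (μ : Measure G)
  [μ.IsHaarMeasure]

/-- The orbit maps of the points `σ(f) 0` are equicontinuous, uniformly over all affine actions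
`σ` with bounded displacement. -/
theorem eventually_norm_translate_le {S : Set G} (hS : IsCompact S) (hS_symm : S⁻¹ = S)
    (hS_one : (1 : G) ∈ S) (hS_gen : Subgroup.closure S = ⊤) {M : ℝ} (hM : 1 ≤ M)
    {f : C_c(G, ℂ)} (hf : ∫ g, f g ∂μ = 1) {ε : ℝ} (hε : 0 < ε) :
    ∀ᶠ g in 𝓝 (1 : G), ∀ ρ : BanachRep.{u, v} G, (∀ s ∈ S, ‖ρ.π s‖ ≤ M) →
      ∀ b ∈ ρ.Z1, (∀ s ∈ S, ‖b s‖ ≤ 1) →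
        ‖b g + ρ.π g (∫ h, f h • b h ∂μ) - ∫ h, f h • b h ∂μ‖ ≤ ε := by
  obtain ⟨K, hK, hK1⟩ := exists_compact_mem_nhds (1 : G)
  have hKf : IsCompact (K * tsupport f) := hK.mul f.hasCompactSupport
  obtain ⟨C, hC0, hC⟩ := exists_uniform_bound.{u, v} hS hS_symm hS_one hS_gen hM hKf
  have hzero : ∀ g ∈ K, ∀ h, h ∉ K * tsupport f → f (g⁻¹ * h) - f h = 0 := by
    intro g hg h hh
    have h1 : g⁻¹ * h ∉ tsupport f := fun h1 => hh ⟨g, hg, g⁻¹ * h, h1, by simp⟩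
    have h2 : h ∉ tsupport f := fun h2 => hh ⟨1, mem_of_mem_nhds hK1, h, h2, by simp⟩
    rw [image_eq_zero_of_notMem_tsupport h1, image_eq_zero_of_notMem_tsupport h2, sub_zero]
  have hfc := f.continuous
  have hcont : ContinuousOn (fun g => ∫ h, ‖f (g⁻¹ * h) - f h‖ ∂μ) K := by
    refine continuousOn_integral_of_compact_support hKf ?_ ?_
    · exact Continuous.continuousOn (by fun_prop)
    · intro g h hg hh
      rw [hzero g hg h hh, norm_zero]
  -- Continuity of translation in `L¹`, which does not involve the action.
  have htend : Tendsto (fun g => ∫ h, ‖f (g⁻¹ * h) - f h‖ ∂μ) (𝓝 1) (𝓝 0) := by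
    have := (hcont.continuousAt hK1).tendsto
    simpa using this
  have hη : 0 < ε / (C + 1) := by positivity
  filter_upwards [hK1, htend.eventually (gt_mem_nhds hη)] with g hgK hg ρ hρ b hb hb1
  have hint2 := integrable_smul_of_continuous μ f hb.1
  have hshift : Continuous fun h => f (g⁻¹ * h) := by fun_prop
  have hintn : Integrable (fun h => ‖f (g⁻¹ * h) - f h‖) μ :=
    Continuous.integrable_of_hasCompactSupport (by fun_prop)
      (HasCompactSupport.intro hKf fun h hh => by rw [hzero g hgK h hh, norm_zero])
  have hint1 : Integrable (fun h => f (g⁻¹ * h) • b h) μ := by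
    have h1 : Integrable (fun h => f h • b (g * h)) μ :=
      integrable_smul_of_continuous μ f (hb.1.comp (continuous_const_mul g))
    have h2 := h1.comp_mul_left g⁻¹
    simpa using h2
  -- Left invariance moves `g` from the action onto `f`.
  have heq : b g + ρ.π g (∫ h, f h • b h ∂μ) - ∫ h, f h • b h ∂μ
      = ∫ h, (f (g⁻¹ * h) - f h) • b h ∂μ := by
    rw [← integral_smul_cocycle_mul μ ρ hb hf]
    have h1 := integral_mul_left_eq_self (μ := μ) (fun h => f (g⁻¹ * h) • b h) g
    simp only [inv_mul_cancel_left] at h1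
    rw [h1, ← integral_sub hint1 hint2]
    simp only [sub_smul]
  rw [heq]
  calc ‖∫ h, (f (g⁻¹ * h) - f h) • b h ∂μ‖ ≤ ∫ h, ‖f (g⁻¹ * h) - f h‖ * C ∂μ := by
        refine norm_integral_le_of_norm_le (hintn.mul_const C) (Eventually.of_forall fun h => ?_)
        rw [norm_smul]
        by_cases hh : h ∈ K * tsupport f
        · have := (hC ρ hρ).2 b hb 1 hb1 h hh
          rw [mul_one] at this
          exact mul_le_mul_of_nonneg_left this (norm_nonneg _)
        · simp [hzero g hgK h hh]
    _ = (∫ h, ‖f (g⁻¹ * h) - f h‖ ∂μ) * C := integral_mul_const _ _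
    _ ≤ ε / (C + 1) * (C + 1) := mul_le_mul hg.le (by linarith) hC0 hη.le
    _ = ε := by field_simp

theorem norm_sum_sub_sum_le {E : Type*} [SeminormedAddCommGroup E] {n : ℕ} {x y : Fin n → E}
    {r : ℝ} (h : ∀ k, ‖x k - y k‖ ≤ r) : ‖∑ k, x k - ∑ k, y k‖ ≤ n * r := by
  rw [← Finset.sum_sub_distrib]
  refine (norm_sum_le _ _).trans ((Finset.sum_le_sum fun k _ => h k).trans ?_)
  simp

variable {X : Type*} {ρ : X → BanachRep.{u, v} G} {b : ∀ c, G → (ρ c).E}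

/-- The vectors `x k` are approximated by combinations `ι (a k)` of values of the limit cocycle, and
the same combinations of the cocycles `b c` serve as the vectors `x'`. Discretising the integrals
leaves finitely many coefficients, on which the norms converge uniformly. -/
theorem eventually_isClose {l : Filter X} (hρ : BddOnCompacts (Set.range ρ))
    (hb : ∀ c, b c ∈ (ρ c).Z1) (hbdd : ∀ g, ∃ B, ∀ c, ‖b c g‖ ≤ B)
    (hequi : ∀ ε > 0, ∀ᶠ g in 𝓝 (1 : G), ∀ c, ‖b c g‖ ≤ ε)
    {ρ' : BanachRep.{u, v} G} {ι : (G →₀ ℂ) →ₗ[ℂ] ρ'.E} (hι : DenseRange ι)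
    (hshift : ∀ g a, ρ'.π g (ι a) = ι (cocycleShift g a))
    (hlim : ∀ a, Tendsto (fun c => ‖Finsupp.linearCombination ℂ (b c) a‖) l (𝓝 ‖ι a‖))
    {n : ℕ} (x : Fin n → ρ'.E) {Q : Set G} (hQ : IsCompact Q) {ε : ℝ} (hε : 0 < ε) :
    ∀ᶠ c in l, IsClose μ ρ' x Q ε (ρ c) := by
  obtain ⟨C₁, hC₁⟩ := hρ Q hQ
  obtain ⟨C₂, hC₂⟩ := ρ'.exists_bound_on_compact hQ
  set C : ℝ := max (max C₁ C₂) 0 with hCdef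
  have hC0 : 0 ≤ C := le_max_right _ _
  have hCρ : ∀ c, ∀ g ∈ Q, ‖(ρ c).π g‖ ≤ C := fun c g hg =>
    (hC₁ _ ⟨c, rfl⟩ g hg).trans ((le_max_left _ _).trans (le_max_left _ _))
  have hCρ' : ∀ g ∈ Q, ‖ρ'.π g‖ ≤ C := fun g hg =>
    (hC₂ g hg).trans ((le_max_right _ _).trans (le_max_left _ _))
  -- Three errors of size `n * C * η` (two discretisations and the replacement of `x k` by `ι (a
  -- k)`) and one of size `η` for the norms add up to `ε / 2`.
  set η : ℝ := ε / (2 * (3 * n * C + 1)) with hηdef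
  have hη : 0 < η := by positivity
  choose a ha using fun k => hι.exists_dist_lt (x k) hη
  have hU : {g : G | ∀ k, (∀ c, ‖(ρ c).π g (Finsupp.linearCombination ℂ (b c) (a k))
        - Finsupp.linearCombination ℂ (b c) (a k)‖ ≤ η) ∧
      ‖ρ'.π g (ι (a k)) - ι (a k)‖ ≤ η} ∈ 𝓝 (1 : G) := by
    refine eventually_all.2 fun k =>
      (eventually_norm_linearCombination_sub_le hρ hb hequi (a k) η hη).and ?_
    have h1 := (ρ'.continuous_apply (ι (a k))).tendsto 1
    rw [map_one] at h1
    filter_upwards [Metric.tendsto_nhds.1 h1 η hη] with g hg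
    rw [dist_eq_norm] at hg
    exact hg.le
  obtain ⟨N, t, htQ, happrox⟩ := exists_integral_approx.{u, v} μ hQ hU
  filter_upwards [eventually_abs_norm_sub_norm_le (fun c => Finsupp.linearCombination ℂ (b c))
    (exists_bound_linearCombination hbdd) ι hlim
    (fun p : Fin n × Fin N => cocycleShift (t p.2) (a p.1)) hη] with c hc
  refine ⟨fun k => Finsupp.linearCombination ℂ (b c) (a k), ε / 2, half_lt_self hε,
    fun f hf => ?_⟩
  choose A hA1 hA using fun k => happrox (f k) (hf k).1
  have hmul : ∀ k (r : ℝ), 0 ≤ r → (∫ g, ‖f k g‖ ∂μ) * r ≤ r := fun k r hr =>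
    mul_le_of_le_one_left hr (hf k).2
  have hbase : ∀ (τ : BanachRep.{u, v} G) (y : Fin n → τ.E), (∀ g ∈ Q, ‖τ.π g‖ ≤ C) →
      (∀ g ∈ {g : G | ∀ k, (∀ c, ‖(ρ c).π g (Finsupp.linearCombination ℂ (b c) (a k))
        - Finsupp.linearCombination ℂ (b c) (a k)‖ ≤ η) ∧
        ‖ρ'.π g (ι (a k)) - ι (a k)‖ ≤ η}, ∀ k, ‖τ.π g (y k) - y k‖ ≤ η) →
      ‖∑ k, τ.op μ (f k) (y k) - ∑ k, ∑ j, A k j • τ.π (t j) (y k)‖ ≤ n * (C * η) := by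
    intro τ y hτ hy
    refine norm_sum_sub_sum_le fun k => ?_
    refine (hA k τ.E (fun g => τ.π g (y k)) (τ.continuous_apply _) (C * η) fun j g hg => ?_).trans
      (hmul k _ (by positivity))
    rw [map_mul, mul_apply_eq_comp, ← map_sub]
    exact (τ.π (t j)).le_of_opNorm_le_of_le (hτ _ (htQ j)) (hy g hg k)
  have h1 := hbase (ρ c) _ (hCρ c) fun g hg k => (hg k).1 c
  have h2 := hbase ρ' (fun k => ι (a k)) hCρ' fun g hg k => (hg k).2
  have h3 : ‖∑ k, ρ'.op μ (f k) (x k) - ∑ k, ρ'.op μ (f k) (ι (a k))‖ ≤ n * (C * η) := by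
    refine norm_sum_sub_sum_le fun k => ?_
    rw [← map_sub]
    have h4 := ρ'.norm_integral_le μ (f k) (fun g hg => hCρ' g ((hf k).1 hg)) (x k - ι (a k))
    refine h4.trans ?_
    rw [mul_assoc]
    refine (hmul k _ (by positivity)).trans ?_
    gcongr
    rw [← dist_eq_norm]
    exact (ha k).le
  have h4 := hc (fun p => A p.1 p.2) fun p => (hA1 p.1 p.2).trans (hf p.1).2
  have h5 : Finsupp.linearCombination ℂ (b c) (∑ p : Fin n × Fin N, A p.1 p.2 •
      cocycleShift (t p.2) (a p.1))
      = ∑ k, ∑ j, A k j • (ρ c).π (t j) (Finsupp.linearCombination ℂ (b c) (a k)) := by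
    rw [Fintype.sum_prod_type]
    simp only [map_sum, map_smul, linearCombination_cocycleShift (ρ c) (hb c)]
  have h6 : ι (∑ p : Fin n × Fin N, A p.1 p.2 • cocycleShift (t p.2) (a p.1))
      = ∑ k, ∑ j, A k j • ρ'.π (t j) (ι (a k)) := by
    rw [Fintype.sum_prod_type]
    simp only [map_sum, map_smul, hshift]
  rw [h5, h6] at h4
  have h1' := (abs_norm_sub_norm_le _ _).trans h1
  have h2' := (abs_norm_sub_norm_le _ _).trans h2
  have h3' := (abs_norm_sub_norm_le _ _).trans h3
  have h7 : 3 * (n * (C * η)) + η = ε / 2 := by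
    have : 3 * (n * (C * η)) + η = (3 * n * C + 1) * η := by ring
    rw [this, hηdef]
    field_simp
  rw [abs_le] at *
  constructor <;> linarith [h1'.1, h1'.2, h2'.1, h2'.2, h3'.1, h3'.2, h4.1, h4.2]

end Convergence

end BanachRep

/-! ### The limit cocycle and its displacement -/

namespace BanachRep

section LimitCocycle

open Filter

variable {G : Type u} [Group G] [TopologicalSpace G] {X : Type*} {l : Filter X} [l.NeBot]
  {ρ : X → BanachRep.{u, v} G} {b : ∀ c, G → (ρ c).E} {ρ' : BanachRep.{u, v} G}
  {ι : (G →₀ ℂ) →ₗ[ℂ] ρ'.E}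

theorem norm_le_of_limit (hb : ∀ c, b c ∈ (ρ c).Z1) (hι : DenseRange ι)
    (hshift : ∀ g a, ρ'.π g (ι a) = ι (cocycleShift g a))
    (hlim : ∀ a, Tendsto (fun c => ‖Finsupp.linearCombination ℂ (b c) a‖) l (𝓝 ‖ι a‖))
    {g : G} {C : ℝ} (hC0 : 0 ≤ C) (hC : ∀ c, ‖(ρ c).π g‖ ≤ C) : ‖ρ'.π g‖ ≤ C := by
  refine ContinuousLinearMap.opNorm_le_bound _ hC0 fun x => ?_
  refine hι.induction_on x (isClosed_le (by fun_prop) (by fun_prop)) fun a => ?_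
  rw [hshift]
  refine le_of_tendsto_of_tendsto' (hlim _) ((hlim a).const_mul C) fun c => ?_
  rw [linearCombination_cocycleShift (ρ c) (hb c)]
  exact ((ρ c).π g).le_of_opNorm_le (hC c) _

theorem norm_limitCocycle_le
    (hlim : ∀ a, Tendsto (fun c => ‖Finsupp.linearCombination ℂ (b c) a‖) l (𝓝 ‖ι a‖))
    {g : G} {D : ℝ} (hD : ∀ c, ‖b c g‖ ≤ D) : ‖ι (Finsupp.single g 1)‖ ≤ D := by
  refine le_of_tendsto' (hlim _) fun c => ?_
  rw [Finsupp.linearCombination_single, one_smul]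
  exact hD c

/-- The definition of `cocycleShift` encodes the cocycle identity. Equicontinuity gives continuity
at `1`, and the identity transports it to every point. -/
theorem limitCocycle_mem_Z1 [IsTopologicalGroup G]
    (hequi : ∀ ε > 0, ∀ᶠ g in 𝓝 (1 : G), ∀ c, ‖b c g‖ ≤ ε)
    (hshift : ∀ g a, ρ'.π g (ι a) = ι (cocycleShift g a))
    (hlim : ∀ a, Tendsto (fun c => ‖Finsupp.linearCombination ℂ (b c) a‖) l (𝓝 ‖ι a‖)) :
    (fun g => ι (Finsupp.single g 1)) ∈ ρ'.Z1 := by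
  have hmul : ∀ g h, ι (Finsupp.single (g * h) 1)
      = ι (Finsupp.single g 1) + ρ'.π g (ι (Finsupp.single h 1)) := by
    intro g h
    rw [hshift]
    simp [cocycleShift]
  have h1 : Tendsto (fun g => ι (Finsupp.single g 1)) (𝓝 1) (𝓝 0) := by
    refine Metric.tendsto_nhds.2 fun ε hε => ?_
    filter_upwards [hequi (ε / 2) (half_pos hε)] with g hg
    rw [dist_zero_right]
    exact (norm_limitCocycle_le hlim hg).trans_lt (half_lt_self hε)
  refine ⟨continuous_iff_continuousAt.2 fun g => ?_, hmul⟩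
  have h2 : Tendsto (fun k => ι (Finsupp.single g 1) + ρ'.π g (ι (Finsupp.single (g⁻¹ * k) 1)))
      (𝓝 g) (𝓝 (ι (Finsupp.single g 1) + ρ'.π g 0)) := by
    refine tendsto_const_nhds.add (((ρ'.π g).continuous.tendsto 0).comp (h1.comp ?_))
    simpa using (continuous_const_mul g⁻¹).tendsto g
  rw [map_zero, add_zero] at h2
  refine h2.congr fun k => ?_
  rw [← hmul, mul_inv_cancel_left]

variable [IsTopologicalGroup G] [T2Space G] [LocallyCompactSpace G] [MeasurableSpace G]
  [BorelSpace G] (μ : Measure G) [μ.IsHaarMeasure]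

/-- The displacement at `σ(m) 0` of the limit affine action controls the displacements of the
affine actions of the family. -/
theorem eventually_displacement_le {𝒰 : Ultrafilter X} (hρ : BddOnCompacts (Set.range ρ))
    (hb : ∀ c, b c ∈ (ρ c).Z1) (hequi : ∀ ε > 0, ∀ᶠ g in 𝓝 (1 : G), ∀ c, ‖b c g‖ ≤ ε)
    (hshift : ∀ g a, ρ'.π g (ι a) = ι (cocycleShift g a))
    (hlim : ∀ a, Tendsto (fun c => ‖Finsupp.linearCombination ℂ (b c) a‖) 𝒰 (𝓝 ‖ι a‖))
    {S : Set G} (hS : IsCompact S) {M : ℝ} (hM : 0 < M) (hρM : ∀ c, ∀ s ∈ S, ‖(ρ c).π s‖ ≤ M)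
    (hρ'M : ∀ s ∈ S, ‖ρ'.π s‖ ≤ M) (m : C_c(G, ℂ)) {r r' : ℝ} (hrr' : r < r')
    (hr : ∀ s ∈ S, ‖ι (Finsupp.single s 1)
      + ρ'.π s (∫ g, m g • ι (Finsupp.single g 1) ∂μ) - ∫ g, m g • ι (Finsupp.single g 1) ∂μ‖ ≤ r)
    {s : X → G} (hs : ∀ c, s c ∈ S) :
    ∀ᶠ c in (𝒰 : Filter X), ‖b c (s c) + (ρ c).π (s c) (∫ g, m g • b c g ∂μ)
      - ∫ g, m g • b c g ∂μ‖ ≤ r' := by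
  have hZ1 := limitCocycle_mem_Z1 hequi hshift hlim
  set δ : ℝ := r' - r with hδ
  have hδ0 : 0 < δ := sub_pos.2 hrr'
  have hQ : IsCompact (tsupport m) := m.hasCompactSupport
  obtain ⟨C₁, hC₁⟩ := hρ _ hQ
  obtain ⟨C₂, hC₂⟩ := ρ'.exists_bound_on_compact hQ
  set C : ℝ := max (max C₁ C₂) 0 with hCdef
  have hC0 : 0 ≤ C := le_max_right _ _
  have hCρ : ∀ c, ∀ g ∈ tsupport m, ‖(ρ c).π g‖ ≤ C := fun c g hg =>
    (hC₁ _ ⟨c, rfl⟩ g hg).trans ((le_max_left _ _).trans (le_max_left _ _))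
  have hCρ' : ∀ g ∈ tsupport m, ‖ρ'.π g‖ ≤ C := fun g hg =>
    (hC₂ g hg).trans ((le_max_right _ _).trans (le_max_left _ _))
  have hI0 : 0 ≤ ∫ g, ‖m g‖ ∂μ := integral_nonneg fun _ => norm_nonneg _
  -- Replacing the average by a finite combination within `θ` changes a displacement by at most `(M
  -- + 1) * θ = δ / 8`. This is done in the limit and in the family; strict convergence brings the
  -- limit bound to `r + δ / 4`, and replacing `s c` by its limit costs another `δ / 4`. The total
  -- is below `r + δ = r'`.
  set θ : ℝ := δ / (8 * (M + 1)) with hθ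
  have hθ0 : 0 < θ := by positivity
  set η : ℝ := θ / ((∫ g, ‖m g‖ ∂μ) * C + 1) with hη
  have hη0 : 0 < η := by positivity
  have hθη : (∫ g, ‖m g‖ ∂μ) * (C * η) ≤ θ := by
    calc (∫ g, ‖m g‖ ∂μ) * (C * η) ≤ ((∫ g, ‖m g‖ ∂μ) * C + 1) * η := by nlinarith
      _ = θ := by rw [hη]; field_simp
  obtain ⟨N, t, htQ, happrox⟩ := exists_integral_approx.{u, v} μ hQ (hequi η hη0)
  obtain ⟨A, -, hA⟩ := happrox m le_rfl
  have hbase : ∀ (τ : BanachRep.{u, v} G) (β : G → τ.E), β ∈ τ.Z1 →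
      (∀ g ∈ tsupport m, ‖τ.π g‖ ≤ C) → (∀ k, (∀ c, ‖b c k‖ ≤ η) → ‖β k‖ ≤ η) →
      ‖∫ g, m g • β g ∂μ - ∑ j, A j • β (t j)‖ ≤ θ := by
    intro τ β hβ hτ hβη
    refine (hA τ.E β hβ.1 (C * η) fun j k hk => ?_).trans hθη
    rw [hβ.2, add_sub_cancel_left]
    exact (τ.π (t j)).le_of_opNorm_le_of_le (hτ _ (htQ j)) (hβη k hk)
  set α : G →₀ ℂ := ∑ j, A j • Finsupp.single (t j) 1 with hα
  have hLα : ∀ c, ‖∫ g, m g • b c g ∂μ - Finsupp.linearCombination ℂ (b c) α‖ ≤ θ := by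
    intro c
    have h1 := hbase (ρ c) (b c) (hb c) (hCρ c) fun k hk => hk c
    have h2 : Finsupp.linearCombination ℂ (b c) α = ∑ j, A j • b c (t j) := by
      rw [hα]
      simp only [map_sum, map_smul, Finsupp.linearCombination_single, one_smul]
    rwa [h2]
  have hια : ‖∫ g, m g • ι (Finsupp.single g 1) ∂μ - ι α‖ ≤ θ := by
    have h1 := hbase ρ' _ hZ1 hCρ' fun k hk => norm_limitCocycle_le hlim hk
    have h2 : ι α = ∑ j, A j • ι (Finsupp.single (t j) 1) := by
      rw [hα]
      simp only [map_sum, map_smul]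
    rwa [h2]
  have hreplace : ∀ (τ : BanachRep.{u, v} G) (z v w : τ.E) (g : G), ‖τ.π g‖ ≤ M → ‖v - w‖ ≤ θ →
      ‖z + τ.π g v - v‖ ≤ ‖z + τ.π g w - w‖ + δ / 8 := by
    intro τ z v w g hg hvw
    have h1 : z + τ.π g v - v = (z + τ.π g w - w) + (τ.π g (v - w) - (v - w)) := by
      rw [map_sub]; abel
    have h2 := (τ.π g).le_of_opNorm_le_of_le hg hvw
    have h3 : M * θ + θ = δ / 8 := by rw [hθ]; field_simp
    rw [h1]
    refine (norm_add_le _ _).trans (add_le_add le_rfl ((norm_sub_le _ _).trans ?_))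
    linarith
  -- The element of `S` varies with `c`; compactness provides a limit `s₀`, and equicontinuity
  -- allows it to replace `s c`.
  obtain ⟨s₀, hs₀, hs₀lim⟩ := hS.ultrafilter_le_nhds (𝒰.map s)
    (le_principal_iff.2 (Filter.mem_map.2 (Filter.univ_mem' hs)))
  have hs₀lim' : Tendsto (fun c => s₀⁻¹ * s c) 𝒰 (𝓝 1) := by
    have h1 : Tendsto s 𝒰 (𝓝 s₀) := hs₀lim
    simpa using h1.const_mul s₀⁻¹
  have hlim₀ := hlim (Finsupp.single s₀ 1 + cocycleShift s₀ α - α)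
  have hι₀ : ‖ι (Finsupp.single s₀ 1 + cocycleShift s₀ α - α)‖ ≤ r + δ / 8 := by
    rw [map_sub, map_add, ← hshift]
    rw [norm_sub_rev] at hια
    exact (hreplace ρ' _ _ _ s₀ (hρ'M s₀ hs₀) hια).trans (by linarith [hr s₀ hs₀])
  have hζ : 0 < δ / (8 * M) := by positivity
  filter_upwards [hlim₀.eventually (gt_mem_nhds (show _ < r + δ / 4 by linarith)),
    hs₀lim'.eventually (hequi _ hζ),
    hs₀lim'.eventually (eventually_norm_linearCombination_sub_le hρ hb hequi α _ hζ)]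
    with c hc₁ hc₂ hc₃
  have h1 := hreplace (ρ c) (b c (s c)) _ _ (s c) (hρM c _ (hs c)) (hLα c)
  set y := Finsupp.linearCombination ℂ (b c) α with hy
  have h2 : Finsupp.linearCombination ℂ (b c) (Finsupp.single s₀ 1 + cocycleShift s₀ α - α)
      = b c s₀ + (ρ c).π s₀ y - y := by
    rw [map_sub, map_add, linearCombination_cocycleShift (ρ c) (hb c),
      Finsupp.linearCombination_single, one_smul]
  rw [h2] at hc₁
  have h3 : b c (s c) + (ρ c).π (s c) y - y = (b c s₀ + (ρ c).π s₀ y - y)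
      + (ρ c).π s₀ (b c (s₀⁻¹ * s c) + ((ρ c).π (s₀⁻¹ * s c) y - y)) := by
    have h4 : b c (s c) = b c s₀ + (ρ c).π s₀ (b c (s₀⁻¹ * s c)) := by
      rw [← (hb c).2, mul_inv_cancel_left]
    have h5 : (ρ c).π (s c) y = (ρ c).π s₀ ((ρ c).π (s₀⁻¹ * s c) y) := by
      rw [← mul_apply_eq_comp, ← map_mul, mul_inv_cancel_left]
    rw [h4, h5, map_add, map_sub]
    abel
  have h6 : ‖(ρ c).π s₀ (b c (s₀⁻¹ * s c) + ((ρ c).π (s₀⁻¹ * s c) y - y))‖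
      ≤ M * (δ / (8 * M) + δ / (8 * M)) :=
    ((ρ c).π s₀).le_of_opNorm_le_of_le (hρM c s₀ hs₀)
      ((norm_add_le _ _).trans (add_le_add (hc₂ c) (hc₃ c)))
  have h7 : M * (δ / (8 * M) + δ / (8 * M)) = δ / 4 := by field_simp; norm_num
  have h8 := norm_add_le (b c s₀ + (ρ c).π s₀ y - y)
    ((ρ c).π s₀ (b c (s₀⁻¹ * s c) + ((ρ c).π (s₀⁻¹ * s c) y - y)))
  rw [← h3] at h8
  linarith

end LimitCocycle

/-! ### Accumulation points in the space of representations -/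

section Topology

variable {G : Type u} [Group G] [TopologicalSpace G] [IsTopologicalGroup G] [MeasurableSpace G]
  [BorelSpace G] (μ : Measure G) [μ.IsHaarMeasure]

theorem map_op_of_intertwines {ρ₁ ρ₂ : BanachRep.{u, v} G} (T : ρ₁.E ≃ₗᵢ[ℂ] ρ₂.E)
    (hT : ∀ g x, T (ρ₁.π g x) = ρ₂.π g (T x)) (f : C_c(G, ℂ)) (x : ρ₁.E) :
    T (ρ₁.op μ f x) = ρ₂.op μ f (T x) := by
  have h := (T.toContinuousLinearEquiv : ρ₁.E →L[ℂ] ρ₂.E).integral_comp_comm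
    (ρ₁.integrable_smul μ f x)
  refine h.symm.trans (integral_congr_ae (Filter.Eventually.of_forall fun g => ?_))
  change T (f g • ρ₁.π g x) = f g • ρ₂.π g (T x)
  rw [map_smul, hT]

/-- Triangle inequality: the slack `ε - δ` leaves room for a basic set centred at `ρ₂`. -/
theorem IsClose.exists_trans {ρ ρ₁ ρ₂ : BanachRep.{u, v} G} {n : ℕ} {x : Fin n → ρ.E} {Q : Set G}
    {ε : ℝ} (h : IsClose μ ρ x Q ε ρ₁) (h₁₂ : Equivalent ρ₁ ρ₂) :
    ∃ y : Fin n → ρ₂.E, ∃ ε' > 0, ∀ ρ₃ : BanachRep.{u, v} G, IsClose μ ρ₂ y Q ε' ρ₃ →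
      IsClose μ ρ x Q ε ρ₃ := by
  obtain ⟨x₁, δ, hδ, hx₁⟩ := h
  obtain ⟨T, hT⟩ := h₁₂
  refine ⟨fun k => T (x₁ k), ε - δ, sub_pos.2 hδ, ?_⟩
  rintro ρ₃ ⟨x₃, δ', hδ', hx₃⟩
  refine ⟨x₃, δ' + δ, by linarith, fun f hf => ?_⟩
  have h1 := hx₁ f hf
  have h3 := hx₃ f hf
  simp only [← map_op_of_intertwines μ T hT, ← map_sum, T.norm_map] at h3
  exact (abs_sub_le _ _ _).trans (add_le_add h3 h1)

/-- A basic open set containing the class of `ρ` may be centred elsewhere; it is first recentred at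
`ρ`, where the hypothesis applies. -/
theorem clusterPt_fellTopology {S : Set G} {M : ℝ} {𝒰 : Ultrafilter (RepSpace.{u, v} S M)}
    {r : RepSpace.{u, v} S M → Rep.{u, v} S M} (hr : ∀ c, (r c).cls = c) {ρ : Rep.{u, v} S M}
    (h : ∀ (n : ℕ) (x : Fin n → ρ.1.E) (Q : Set G), IsCompact Q → ∀ ε > 0,
      ∀ᶠ c in (𝒰 : Filter (RepSpace.{u, v} S M)), IsClose μ ρ.1 x Q ε (r c).1) :
    @ClusterPt _ (fellTopology μ S M) ρ.cls (𝒰 : Filter (RepSpace.{u, v} S M)) := by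
  let := fellTopology.{u, v} μ S M
  refine ClusterPt.of_le_nhds ?_
  rw [TopologicalSpace.nhds_generateFrom]
  refine le_iInf₂ fun V hV => ?_
  obtain ⟨hρV, ρ₀, n, x, Q, ε, hQ, -, rfl⟩ := hV
  obtain ⟨ρ₁, hρ₁, hclose⟩ := hρV
  obtain ⟨y, ε', hε', hy⟩ := hclose.exists_trans μ (Quotient.exact hρ₁ : Equivalent ρ₁.1 ρ.1)
  refine Filter.le_principal_iff.2 ?_
  filter_upwards [h n y Q hQ ε' hε'] with c hc
  exact ⟨r c, hr c, hy _ hc⟩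

end Topology

end BanachRep

/-! ### Stability of contraction and the theorem -/

namespace BanachRep

theorem norm_le_of_mem_reps {G : Type u} [Group G] [TopologicalSpace G] {S : Set G} {M : ℝ}
    {F : Set (RepSpace.{u, v} S M)} {ρ : BanachRep.{u, v} G}
    (hρ : ρ ∈ RepSpace.reps F) : ∀ g ∈ S, ‖ρ.π g‖ ≤ M := by
  obtain ⟨ρ', rfl, -⟩ := hρ
  exact ρ'.2.2

section Main

open Filter

variable {G : Type u} [Group G] [TopologicalSpace G] [IsTopologicalGroup G] [T2Space G]
  [LocallyCompactSpace G] [TopologicalSpace.SeparableSpace G] [MeasurableSpace G] [BorelSpace G]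
  (μ : Measure G) [μ.IsHaarMeasure] {S : Set G}

/-- If `m` contracts displacements strongly enough for the representations in `F`, then the
representations for which `m * f` contracts displacements form a strong neighbourhood of `F`. -/
theorem isStrongNhd_contracts (hS : IsCompact S) (hS_symm : S⁻¹ = S)
    (hS_one : (1 : G) ∈ S) (hS_gen : Subgroup.closure S = ⊤) {M : ℝ} (hM : 1 ≤ M)
    {f : C_c(G, ℂ)} (hf : ∫ g, f g ∂μ = 1) {C : ℝ}
    (hC : ∀ ρ : BanachRep.{u, v} G, (∀ g ∈ S, ‖ρ.π g‖ ≤ M) → ∀ b ∈ ρ.Z1, (∀ s ∈ S, ‖b s‖ ≤ 1) →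
      ∀ s ∈ S, ‖b s + ρ.π s (∫ g, f g • b g ∂μ) - ∫ g, f g • b g ∂μ‖ ≤ C)
    {m : C_c(G, ℂ)} (hm : ∫ g, m g ∂μ = 1) {κ κ' : ℝ} (hκ : κ * C < κ')
    {F : Set (RepSpace.{u, v} S M)} (hF : ∀ ρ ∈ RepSpace.reps F, Contracts μ S m κ ρ) :
    IsStrongNhd (fellTopology μ S M)
      {c | ∀ ρ : Rep.{u, v} S M, ρ.cls = c → Contracts μ S (conv μ m f) κ' ρ.1} F := by
  intro 𝒰 h𝒰
  set F' : Set (RepSpace.{u, v} S M) :=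
    {c | ∀ ρ : Rep.{u, v} S M, ρ.cls = c → Contracts μ S (conv μ m f) κ' ρ.1} with hF'
  by_contra hnot
  -- Classes outside `F'` receive a violating cocycle of displacement at most 1, on a representative
  -- where contraction fails; the others receive the zero cocycle, so that the family is indexed by
  -- the whole space.
  have hchoice : ∀ c : RepSpace.{u, v} S M, ∃ (r : Rep.{u, v} S M) (b : G → r.1.E) (s : G),
      r.cls = c ∧ b ∈ r.1.Z1 ∧ (∀ s ∈ S, ‖b s‖ ≤ 1) ∧ s ∈ S ∧ (c ∉ F' →
        κ' < ‖b s + r.1.π s (∫ g, conv μ m f g • b g ∂μ) - ∫ g, conv μ m f g • b g ∂μ‖) := by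
    intro c
    by_cases hc : c ∈ F'
    · obtain ⟨r, hr⟩ := Quotient.exists_rep c
      exact ⟨r, 0, 1, hr, r.1.Z1.zero_mem, by simp, hS_one, fun h => absurd hc h⟩
    · have hc' := hc
      simp only [hF', Set.mem_ofPred_eq, Contracts, not_forall, not_le] at hc'
      obtain ⟨r, hr, b, hb, hb1, s, hs, hlt⟩ := hc'
      exact ⟨r, b, s, hr, hb, hb1, hs, fun _ => hlt⟩
  choose r b s hr hb hb1 hs hbad using hchoice
  let ρ : RepSpace.{u, v} S M → BanachRep.{u, v} G := fun c => (r c).1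
  have hρM : ∀ c, ∀ g ∈ S, ‖(ρ c).π g‖ ≤ M := fun c => (r c).2.2
  let w : ∀ c, (ρ c).E := fun c => ∫ g, f g • b c g ∂μ
  -- The cocycles `b c` need not be equicontinuous; with base point moved to `σ(f) 0` they are, at
  -- the price of displacement `C` in place of 1.
  let b' : ∀ c, G → (ρ c).E := fun c g => b c g + (ρ c).π g (w c) - w c
  have hb' : ∀ c, b' c ∈ (ρ c).Z1 := fun c => (ρ c).translate_mem_Z1 (hb c) (w c)
  have hb'C : ∀ c, ∀ t ∈ S, ‖b' c t‖ ≤ C := fun c => hC _ (hρM c) _ (hb c) (hb1 c)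
  have hρ : BddOnCompacts (Set.range ρ) :=
    bddOnCompacts_of_forall_le hS hS_symm hS_one hS_gen hM (by rintro _ ⟨c, rfl⟩; exact hρM c)
  have hequi : ∀ ε > 0, ∀ᶠ g in 𝓝 (1 : G), ∀ c, ‖b' c g‖ ≤ ε := by
    intro ε hε
    filter_upwards [eventually_norm_translate_le.{u, v} μ hS hS_symm hS_one hS_gen hM hf hε]
      with g hg c
    exact hg _ (hρM c) _ (hb c) (hb1 c)
  have hbdd : ∀ g, ∃ B, ∀ c, ‖b' c g‖ ≤ B := by
    intro g
    obtain ⟨B, -, hB⟩ := exists_uniform_bound.{u, v} hS hS_symm hS_one hS_gen hM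
      (isCompact_singleton (x := g))
    exact ⟨B * C, fun c => (hB _ (hρM c)).2 _ (hb' c) C (hb'C c) g rfl⟩
  obtain ⟨ρ', ι, hsep, hι, hshift, hlim⟩ := exists_ultralimit_rep 𝒰 hρ hb' hbdd hequi
  have hρ'M : ∀ g ∈ S, ‖ρ'.π g‖ ≤ M := fun g hg =>
    norm_le_of_limit hb' hι hshift hlim (zero_le_one.trans hM) fun c => hρM c g hg
  have hcluster := clusterPt_fellTopology μ (𝒰 := 𝒰) (r := r) hr (ρ := ⟨ρ', hsep, hρ'M⟩)
    fun n x Q hQ ε hε => eventually_isClose μ hρ hb' hbdd hequi hι hshift hlim x hQ hε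
  have hcontr := hF ρ' ⟨⟨ρ', hsep, hρ'M⟩, rfl, h𝒰 _ hcluster⟩
  -- In the limit `m` brings the displacement from `C` down to `κ * C < κ'`. Since `σ(m * f) 0 =
  -- σ(m) (σ(f) 0)`, this contradicts the choice of `b c` on classes outside `F'`.
  have hdisp := eventually_displacement_le μ hρ hb' hequi hshift hlim hS (zero_lt_one.trans_le hM)
    hρM hρ'M m hκ (fun t ht => hcontr.le_mul (limitCocycle_mem_Z1 hequi hshift hlim)
      (fun t ht => norm_limitCocycle_le hlim fun c => hb'C c t ht) ht) hs
  obtain ⟨c, hc, hcF'⟩ := (hdisp.and (Ultrafilter.compl_mem_iff_notMem.2 hnot)).exists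
  refine (hbad c hcF').not_ge (le_of_eq_of_le ?_ hc)
  rw [integral_conv_smul_cocycle μ (ρ c) (hb c) hm hf (w := w c) rfl, map_add]
  congr 1
  simp only [b']
  abel

end Main

end BanachRep

theorem theorem4p1 {G : Type u} [Group G] [TopologicalSpace G] [IsTopologicalGroup G]
    [T2Space G] [LocallyCompactSpace G] [TopologicalSpace.SeparableSpace G]
    [MeasurableSpace G] [BorelSpace G] (μ : Measure G) [μ.IsHaarMeasure]
    (S : Set G) (hS_compact : IsCompact S) (hS_symm : S⁻¹ = S) (hS_one : (1 : G) ∈ S)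
    (hS_gen : Subgroup.closure S = ⊤)
    (M : ℝ) (hM : 1 < M) (F : Set (BanachRep.RepSpace.{u, v} S M))
    (hF : BanachRep.HasKazhdanProjection μ (BanachRep.RepSpace.reps F))
    (hF_H1 : ∀ ρ ∈ BanachRep.RepSpace.reps F, Subsingleton ρ.H1) :
    ∃ F' : Set (BanachRep.RepSpace.{u, v} S M),
      IsStrongNhd (BanachRep.fellTopology μ S M) F' F ∧
      BanachRep.HasKazhdanProjection μ (BanachRep.RepSpace.reps F') ∧
      ∀ ρ ∈ BanachRep.RepSpace.reps F', Subsingleton ρ.H1 := by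
  have hM1 := hM.le
  have hFM : ∀ ρ ∈ BanachRep.RepSpace.reps F, ∀ g ∈ S, ‖ρ.π g‖ ≤ M :=
    fun ρ => BanachRep.norm_le_of_mem_reps
  -- Only a compactly supported function of integral 1 is wanted here; its contraction property is
  -- discarded.
  obtain ⟨f, hf, -⟩ := hF.exists_contracts μ hS_compact hS_symm hS_one hS_gen hM1 hFM hF_H1
    one_pos
  obtain ⟨C₀, hC₀, hfC₀⟩ := BanachRep.exists_bound_integral_cocycle.{u, v} μ hS_compact hS_symm
    hS_one hS_gen hM1 f
  have hC : ∀ ρ : BanachRep.{u, v} G, (∀ g ∈ S, ‖ρ.π g‖ ≤ M) → ∀ b ∈ ρ.Z1,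
      (∀ s ∈ S, ‖b s‖ ≤ 1) → ∀ s ∈ S,
      ‖b s + ρ.π s (∫ g, f g • b g ∂μ) - ∫ g, f g • b g ∂μ‖ ≤ 1 + M * C₀ + C₀ := by
    intro ρ hρ b hb hb1 s hs
    have h1 := hfC₀ ρ hρ b hb 1 hb1
    rw [mul_one] at h1
    exact (norm_sub_le _ _).trans (add_le_add ((norm_add_le _ _).trans
      (add_le_add (hb1 s hs) ((ρ.π s).le_of_opNorm_le_of_le (hρ s hs) h1))) h1)
  have hpos : 0 < 1 + M * C₀ + C₀ := by positivity
  -- Here `κ` times the smoothing constant is `1 / 4`, strictly less than the factor `κ' = 1 / 2`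
  -- required on `F'`.
  obtain ⟨m, hm, hmF⟩ := hF.exists_contracts μ hS_compact hS_symm hS_one hS_gen hM1 hFM hF_H1
    (κ := 1 / (4 * (1 + M * C₀ + C₀))) (by positivity)
  refine ⟨_, BanachRep.isStrongNhd_contracts μ hS_compact hS_symm hS_one hS_gen hM1 hf hC hm
    (κ' := 1 / 2) ?_ hmF, ?_, fun ρ hρ => ?_⟩
  · have : 1 / (4 * (1 + M * C₀ + C₀)) * (1 + M * C₀ + C₀) = 1 / 4 := by field_simp
    rw [this]
    norm_num
  · refine BanachRep.hasKazhdanProjection_of_contracts μ hS_compact hS_symm hS_one hS_gen hM1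
      (fun ρ => BanachRep.norm_le_of_mem_reps) (m := BanachRep.conv μ m f) ?_ (κ := 1 / 2)
      (by norm_num) (by norm_num) ?_
    · rw [BanachRep.integral_conv, hm, hf, mul_one]
    · rintro _ ⟨ρ, rfl, hρ⟩
      exact hρ ρ rfl
  · have hρM := BanachRep.norm_le_of_mem_reps hρ
    obtain ⟨ρ, rfl, hρ⟩ := hρ
    exact (hρ ρ rfl).subsingleton_H1 μ hS_compact hS_symm hS_one hS_gen hM1 hρM
      (by norm_num) (by norm_num)
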